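/- Let $p>2$ be a prime, $F$ a finite extension of $\mathbb Q_p$ with uniformizer $\varpi$, normalized valuation $v$ (also extended to $E$; $v(0)=\infty$), ring of integers $\mathcal O_F$ and residue field of cardinality $q$. Let $E/F$ be the unramified quadratic extension, $x\mapsto\bar x$ its nontrivial automorphism, $\eta(x)=(-1)^{v(x)}$ and $|x|_F=q^{-v(x)}$ for $x\in F^\times$. Let $S_2(F)=\{g\in \mathrm{GL}_2(E): g\bar g=1\}$ and, for an integer $r\ge 0$, $K'_{S,\le r}=\{g\in S_2(F): \varpi^r g\in \mathrm{Mat}_2(\mathcal O_E)\}$. For $\gamma\in S_2(F)$, a column vector $\mathbf u\in F^2$ and a row vector $\mathbf v^\top$ over $F$, put $$\mathrm{Orb}((\gamma,\mathbf u,\mathbf v^\top),\mathbf 1_{K'_{S,\le r}},s)=\int_{\mathrm{GL}_2(F)}\mathbf 1_{K'_{S,\le r}}(h\gamma h^{-1})\,\mathbf 1_{\mathcal O_F^2\times(\mathcal O_F^2)^\vee}(h\mathbf u,\mathbf v^\top h^{-1})\,\eta(\det h)\,|\det h|_F^{-s}\,dh,$$ where $dh$ is the Haar measure giving $\mathrm{GL}_2(\mathcal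 O_F)$ volume $1$, and let $\partial\mathrm{Orb}$ denote its derivative in $s$ at $s=0$. Consider triples $(\gamma,\mathbf u,\mathbf v^\top)=\left(\begin{pmatrix}a&b\\c&d\end{pmatrix},\begin{pmatrix}0\\1\end{pmatrix},\begin{pmatrix}0&e\end{pmatrix}\right)$ with $\gamma\in S_2(F)$, $e\in F$, $b,c,e\ne 0$ and $v(1-a\bar a)$ odd (equivalently, the triple is regular semisimple and matches the non-split unitary group). Then $v(b)+v(c)$ is odd and positive, and $v(d-a)\in\{0,1,2,\dots\}\cup\{\infty\}$. Write $\partial\mathrm{Orb}(r,v(b),v(c),v(e),v(d-a))$ for $\partial\mathrm{Orb}((\gamma,\mathbf u,\mathbf v^\top),\mathbf 1_{K'_{S,\le r}})$ for any such triple with these valuations; the theorem includes that the identity below holds whichever triples are used. Put $$n_1=\min\bigl(2v(e),\,v(b)+v(c)+2r,\,2v(d-a)+2r\bigr),\qquad n_2=2v(e)+v(b)+v(c)+2r-n_1,$$ $$\mathrm{GK}(r,v(b),v(c),v(e),v(d-a))=\begin{cases}\displaystyle\sum_{j=0}^{(n_1-1)/2}(n_1+n_2-4j)q^j & n_1\text{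 odd},\\[2ex] \displaystyle\frac{n_2-n_1+1}{2}\,q^{n_1/2}+\sum_{j=0}^{n_1/2-1}(n_1+n_2-4j)q^j & n_1\text{ even}.\end{cases}$$ Theorem. If $r\ge 0$ and $v(e)\ge 0$, the integrals defining the two orbital integrals involved (at $v(e)$ and at $v(e)-1$) converge absolutely for every $s\in\mathbb C$ and are differentiable in $s$ at $s=0$, and $$\frac{(-1)^{r+v(c)}}{\log q}\Bigl(\partial\mathrm{Orb}(r,v(b),v(c),v(e),v(d-a))+\partial\mathrm{Orb}(r,v(b),v(c),v(e)-1,v(d-a))\Bigr)=\mathrm{GK}(r,v(b),v(c),v(e),v(d-a)).$$ -/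

import Mathlib

open MeasureTheory

noncomputable section

namespace SemiLieAFL

section LocalField

variable {F : Type*} [NormedField F]

/-- `ϖ` generates the maximal ideal `{x | ‖x‖ < 1}` of the ring of integers `{x | ‖x‖ ≤ 1}`. -/
def IsUniformizer (ϖ : F) : Prop :=
  ϖ ≠ 0 ∧ ‖ϖ‖ < 1 ∧ ∀ x : F, ‖x‖ < 1 → ‖x‖ ≤ ‖ϖ‖

/-- The cardinality of the residue field of `F`. -/
def residueCard (F : Type*) [NormedField F] [IsUltrametricDist F] : ℕ :=
  Nat.card (IsLocalRing.ResidueField (NormedField.valuation (K := F)).valuationSubring)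

/-- The normalized valuation `v` of a nonzero element `x` of `F` or of an unramified extension
of `F`, i.e. the integer `v` with `‖x‖ = ‖ϖ‖ ^ v`. (Only used at nonzero elements.) -/
def ord {E : Type*} [NormedField E] (ϖ : F) (x : E) : ℤ :=
  ⌊Real.logb ‖ϖ‖ ‖x‖⌋

open Classical in
/-- The normalized valuation, with the convention `v 0 = ∞`. -/
def ordTop {E : Type*} [NormedField E] (ϖ : F) (x : E) : WithTop ℤ :=
  if x = 0 then ⊤ else (ord ϖ x : WithTop ℤ)

/-- The quadratic character of `Fˣ` attached to the unramified quadratic extension of `F`. -/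
def eta (ϖ : F) (x : F) : ℂ :=
  (-1) ^ ord ϖ x

/-- The normalized absolute value of `F` at a nonzero element `x`, so that `|ϖ| = 1 / q`. -/
def normAbs [IsUltrametricDist F] (ϖ : F) (x : F) : ℝ :=
  (residueCard F : ℝ) ^ (-ord ϖ x)

/-- The maximal compact subgroup `GL_n(𝓞_F)` of `GL_n(F)`. -/
def integralGL (n : ℕ) (F : Type*) [NormedField F] :
    Set (Matrix.GeneralLinearGroup (Fin n) F) :=
  {h | ∀ i j, ‖(h : Matrix (Fin n) (Fin n) F) i j‖ ≤ 1 ∧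
    ‖((h⁻¹ : Matrix.GeneralLinearGroup (Fin n) F) : Matrix (Fin n) (Fin n) F) i j‖ ≤ 1}

variable {E : Type*} [NormedField E] [NormedAlgebra F E]

/-- `E / F` is an unramified quadratic extension: it has degree two and ramification index one
(the residue fields are finite, so there is no separability condition). -/
def IsUnramifiedQuadratic (F E : Type*) [NormedField F] [NormedField E] [NormedAlgebra F E] :
    Prop :=
  Module.finrank F E = 2 ∧ ∀ x : E, ∃ y : F, ‖y‖ = ‖x‖

/-- The symmetric space `S_n(F)`: the `g` in `GL_n(E)` with `g * σ(g) = 1`. -/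
def symmetricSpace {n : ℕ} (σ : E ≃ₐ[F] E) : Set (Matrix (Fin n) (Fin n) E) :=
  {g | g * g.map σ = 1}

/-- The set `K'_{S, ≤ r}` of all `g` in `S_n(F)` such that `ϖ ^ r * g` has entries in `𝓞_E`. -/
def boundedSymmetric {n : ℕ} (σ : E ≃ₐ[F] E) (ϖ : F) (r : ℕ) :
    Set (Matrix (Fin n) (Fin n) E) :=
  {g | g ∈ symmetricSpace σ ∧ ∀ i j, ‖algebraMap F E ϖ ^ r * g i j‖ ≤ 1}

/-- The test function `1_{K'_{S, ≤ r}}`. -/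
def testFn {n : ℕ} (σ : E ≃ₐ[F] E) (ϖ : F) (r : ℕ) : Matrix (Fin n) (Fin n) E → ℂ :=
  Set.indicator (boundedSymmetric σ ϖ r) 1

/-- The indicator function of `𝓞_F^n × (𝓞_F^n)^∨`. -/
def latticeIndicator {n : ℕ} (w : (Fin n → F) × (Fin n → F)) : ℂ :=
  Set.indicator {w : (Fin n → F) × (Fin n → F) | (∀ i, ‖w.1 i‖ ≤ 1) ∧ ∀ i, ‖w.2 i‖ ≤ 1} 1 w

/-- The conjugate `h γ h⁻¹` of a matrix over `E` by an element of `GL_n(F)`. -/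
def conj {n : ℕ} (h : Matrix.GeneralLinearGroup (Fin n) F) (γ : Matrix (Fin n) (Fin n) E) :
    Matrix (Fin n) (Fin n) E :=
  (h : Matrix (Fin n) (Fin n) F).map (algebraMap F E) * γ *
    ((h⁻¹ : Matrix.GeneralLinearGroup (Fin n) F) : Matrix (Fin n) (Fin n) F).map (algebraMap F E)

/-- The integrand of the weighted orbital integral: the test function `φ ⊗ 1_{𝓞^n × (𝓞^n)^∨}`
evaluated at `h • (γ, u, vᵀ) = (h γ h⁻¹, h u, vᵀ h⁻¹)`, weighted by `η(det h) |det h|^{-s}`. -/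
def orbIntegrand [IsUltrametricDist F] {n : ℕ} (ϖ : F) (φ : Matrix (Fin n) (Fin n) E → ℂ)
    (γ : Matrix (Fin n) (Fin n) E) (u v : Fin n → F) (s : ℂ)
    (h : Matrix.GeneralLinearGroup (Fin n) F) : ℂ :=
  φ (conj h γ) *
    latticeIndicator (Matrix.mulVec (h : Matrix (Fin n) (Fin n) F) u,
      Matrix.vecMul v
        ((h⁻¹ : Matrix.GeneralLinearGroup (Fin n) F) : Matrix (Fin n) (Fin n) F)) *
    eta ϖ (h : Matrix (Fin n) (Fin n) F).det *
    ((normAbs ϖ (h : Matrix (Fin n) (Fin n) F).det : ℝ) : ℂ) ^ (-s)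

/-- The weighted orbital integral `Orb((γ, u, vᵀ), φ ⊗ 1_{𝓞^n × (𝓞^n)^∨}, s)`. -/
def weightedOrb [IsUltrametricDist F] {n : ℕ}
    [MeasurableSpace (Matrix.GeneralLinearGroup (Fin n) F)]
    (μ : Measure (Matrix.GeneralLinearGroup (Fin n) F)) (ϖ : F)
    (φ : Matrix (Fin n) (Fin n) E → ℂ) (γ : Matrix (Fin n) (Fin n) E) (u v : Fin n → F)
    (s : ℂ) : ℂ :=
  ∫ h, orbIntegrand ϖ φ γ u v s h ∂μ

/-- `∂Orb((γ, u, vᵀ), φ)`, the derivative of the weighted orbital integral at `s = 0`. -/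
def derivOrb [IsUltrametricDist F] {n : ℕ}
    [MeasurableSpace (Matrix.GeneralLinearGroup (Fin n) F)]
    (μ : Measure (Matrix.GeneralLinearGroup (Fin n) F)) (ϖ : F)
    (φ : Matrix (Fin n) (Fin n) E → ℂ) (γ : Matrix (Fin n) (Fin n) E) (u v : Fin n → F) : ℂ :=
  deriv (weightedOrb μ ϖ φ γ u v) 0

/-- The parameters of an orbit representative
`(γ, u, vᵀ) = (!![a, b; c, d], (0, 1)ᵀ, (0, e))`: the matrix `γ` lies in `S_2(F)`, the triple is
regular semisimple, and it is of the type that matches the non-split unitary group. -/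
structure IsNonsplitRep (σ : E ≃ₐ[F] E) (ϖ : F) (a b c d : E) (e : F) : Prop where
  mem_symmetricSpace : !![a, b; c, d] ∈ symmetricSpace σ
  b_ne_zero : b ≠ 0
  c_ne_zero : c ≠ 0
  e_ne_zero : e ≠ 0
  odd_ord : Odd (ord ϖ (1 - a * σ a))

end LocalField

/-- The right-hand side of the Gross-Keating formula for `0 ≤ n₁ ≤ n₂`. -/
def grossKeating (q : ℕ) (n₁ n₂ : ℤ) : ℚ :=
  if Odd n₁ then
    ∑ j ∈ Finset.Icc (0 : ℤ) ((n₁ - 1) / 2), (n₁ + n₂ - 4 * j : ℚ) * (q : ℚ) ^ j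
  else
    (n₂ - n₁ + 1 : ℚ) / 2 * (q : ℚ) ^ (n₁ / 2) +
      ∑ j ∈ Finset.Icc (0 : ℤ) (n₁ / 2 - 1), (n₁ + n₂ - 4 * j : ℚ) * (q : ℚ) ^ j

/-- `n₁ = min(2 v(e), v(b) + v(c) + 2 r, 2 v(d - a) + 2 r)`, where `v(d - a)` may be infinite. -/
def gkIndex (r : ℕ) (vb vc ve : ℤ) (vda : WithTop ℤ) : ℤ :=
  match vda with
  | none => min (2 * ve) (vb + vc + 2 * r)
  | some w => min (min (2 * ve) (vb + vc + 2 * r)) (2 * w + 2 * r)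

/-- The quantity `GK(r, v(b), v(c), v(e), v(d - a))`. -/
def GK (q r : ℕ) (vb vc ve : ℤ) (vda : WithTop ℤ) : ℚ :=
  grossKeating q (gkIndex r vb vc ve vda)
    (2 * ve + vb + vc + 2 * r - gkIndex r vb vc ve vda)

end SemiLieAFL

end

/-! The integrand is invariant under left multiplication by `GL_2(𝓞_F)`. By the Iwasawa
decomposition the integral becomes a sum over the cosets of the matrices `upper (ϖ ^ m) (ϖ ^ n) x`,
where `x` matters only modulo `ϖ ^ n`. Since right translation by these matrices preserves volume,
each coset has volume 1, and the integral is a weighted count of residue classes.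

Write `B = v(b)`, `C = v(c)`. The equation `γ * σ(γ) = 1` gives `c = κ b` and `d - a = τ b` with `κ,
τ` in `F`, and oddness of `v(1 - a σ(a)) = B + C` makes `a` and `d` integral. So a coset lies in the
support iff `0 ≤ n ≤ v(e)`, `i = r + C + n - m ≥ 0`, and `x` is `admissible`, the main condition
being that `α² + τ α x - κ x²` be small for `α = ϖ ^ m`. The determinant has valuation `r + C + 2n -
i`, so the derivative at `s = 0` is `(-1)^(r + C) log q` times the sum of `(-1)^i (r + C + 2n - i)
N(n, i)`, where `N(n, i)` counts the admissible classes.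

As `B + C` is odd, it differs from `2 v(d - a)`, which leaves two regimes. If `2 v(d - a) > B + C`,
the linear term never matters: the admissible set is a ball with `q^min(n, ⌊i/2⌋)` classes for `i ≤
2r + B + C` and is empty afterwards. If `D = v(d - a)` satisfies `2D < B + C`, the same ball occurs
for `i ≤ 2(r + D)`, but afterwards the quadratic splits over `F` and the admissible set consists of
the integral points near either of its two roots (`admissible_eq_union`, counted by `classCount`).

For fixed `n`, the alternating sum over `i` loses its dependence on `r + C + 2n`, because
consecutive terms pair off. The integral at `v(e)` sums `n` up to `v(e)` and the one at `v(e) - 1`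
stops one earlier; adding them makes each increment in `v(e)` a sum of two consecutive inner sums.
These increments give the Gross-Keating polynomial, which becomes linear in `v(e)` once `2 v(e)` is
no longer the minimum defining `n₁`. -/

open MeasureTheory

noncomputable section

namespace SemiLieAFL

/-! ### Upper triangular matrices, the integral subgroup and its cosets -/

section IntegralSubgroup

variable {F : Type*} [NormedField F]

/-- The invertible matrix `!![α, x; 0, β]`. -/
def upper (α β : Fˣ) (x : F) : Matrix.GeneralLinearGroup (Fin 2) F where
  val := !![(α : F), x; 0, (β : F)]
  inv := !![(α : F)⁻¹, -((α : F)⁻¹ * x * (β : F)⁻¹); 0, (β : F)⁻¹]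
  val_inv := by
    ext i j; fin_cases i <;> fin_cases j <;> simp [Matrix.mul_apply, Fin.sum_univ_two]
    field_simp; ring
  inv_val := by
    ext i j; fin_cases i <;> fin_cases j <;> simp [Matrix.mul_apply, Fin.sum_univ_two]

lemma coe_upper (α β : Fˣ) (x : F) :
    (upper α β x : Matrix (Fin 2) (Fin 2) F) = !![(α : F), x; 0, (β : F)] := rfl

lemma coe_upper_inv (α β : Fˣ) (x : F) :
    ((upper α β x)⁻¹ : Matrix.GeneralLinearGroup (Fin 2) F).val =
      !![(α : F)⁻¹, -((α : F)⁻¹ * x * (β : F)⁻¹); 0, (β : F)⁻¹] := rfl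

lemma upper_mul (α β α' β' : Fˣ) (x x' : F) :
    upper α β x * upper α' β' x' = upper (α * α') (β * β') (α * x' + x * β') := by
  apply Units.ext
  rw [Units.val_mul, coe_upper, coe_upper, coe_upper]
  ext i j; fin_cases i <;> fin_cases j <;> simp [Matrix.mul_apply, Fin.sum_univ_two]

lemma upper_one : upper (1 : Fˣ) 1 (0 : F) = 1 := by
  apply Units.ext
  rw [coe_upper]
  ext i j; fin_cases i <;> fin_cases j <;> simp

lemma upper_inv (α β : Fˣ) (x : F) :
    (upper α β x)⁻¹ = upper α⁻¹ β⁻¹ (-((α : F)⁻¹ * x * (β : F)⁻¹)) := by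
  rw [inv_eq_iff_mul_eq_one, upper_mul, ← upper_one]
  congr 1 <;> simp
  field_simp; ring

lemma upper_mem_integralGL {α β : Fˣ} {x : F} :
    upper α β x ∈ integralGL 2 F ↔ ‖(α : F)‖ = 1 ∧ ‖(β : F)‖ = 1 ∧ ‖x‖ ≤ 1 := by
  have key : ∀ γ : Fˣ, ‖(γ : F)‖ ≤ 1 → ‖(γ : F)‖⁻¹ ≤ 1 → ‖(γ : F)‖ = 1 := fun γ h1 h2 =>
    le_antisymm h1 ((inv_le_one₀ (norm_pos_iff.2 γ.ne_zero)).1 h2)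
  constructor
  · intro h
    have h00 := h 0 0
    have h11 := h 1 1
    have h01 := h 0 1
    rw [coe_upper_inv, coe_upper] at h00 h11 h01
    simp only [Matrix.of_apply, Matrix.cons_val', Matrix.cons_val_zero, Matrix.cons_val_one,
      norm_inv] at h00 h11 h01
    exact ⟨key _ h00.1 h00.2, key _ h11.1 h11.2, h01.1⟩
  · rintro ⟨hα, hβ, hx⟩ i j
    rw [coe_upper_inv, coe_upper]
    fin_cases i <;> fin_cases j <;> simp [hα, hβ, hx]

variable [IsUltrametricDist F]

lemma norm_mul_apply_le_one {n : ℕ} {A B : Matrix (Fin n) (Fin n) F} (hA : ∀ i j, ‖A i j‖ ≤ 1)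
    (hB : ∀ i j, ‖B i j‖ ≤ 1) (i j : Fin n) : ‖(A * B) i j‖ ≤ 1 := by
  rw [Matrix.mul_apply]
  refine IsUltrametricDist.norm_sum_le_of_forall_le_of_nonneg zero_le_one fun k _ => ?_
  rw [norm_mul]
  exact mul_le_one₀ (hA i k) (norm_nonneg _) (hB k j)

variable (F) in
/-- `GL_n(𝓞_F)` as a subgroup of `GL_n(F)`. -/
def integralSubgroup (n : ℕ) : Subgroup (Matrix.GeneralLinearGroup (Fin n) F) where
  carrier := integralGL n F
  mul_mem' {g h} hg hh i j := by
    refine ⟨?_, ?_⟩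
    · rw [Units.val_mul]
      exact norm_mul_apply_le_one (fun i j => (hg i j).1) (fun i j => (hh i j).1) i j
    · rw [mul_inv_rev, Units.val_mul]
      exact norm_mul_apply_le_one (fun i j => (hh i j).2) (fun i j => (hg i j).2) i j
  one_mem' i j := by
    rw [inv_one, Units.val_one, Matrix.one_apply]
    split_ifs <;> simp
  inv_mem' {g} hg i j := by
    rw [inv_inv]
    exact (hg i j).symm

lemma mem_integralSubgroup {n : ℕ} {g : Matrix.GeneralLinearGroup (Fin n) F} :
    g ∈ integralSubgroup F n ↔ g ∈ integralGL n F := Iff.rfl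

lemma isOpen_integralGL (n : ℕ) : IsOpen (integralGL n F) := by
  have : integralGL n F = ⋂ i : Fin n, ⋂ j : Fin n,
      ((fun g : Matrix.GeneralLinearGroup (Fin n) F => g.val i j) ⁻¹' Metric.closedBall 0 1 ∩
      (fun g : Matrix.GeneralLinearGroup (Fin n) F => (g⁻¹).val i j) ⁻¹'
        Metric.closedBall 0 1) := by
    ext g
    simp [integralGL]
  rw [this]
  refine isOpen_iInter_of_finite fun i => isOpen_iInter_of_finite fun j => ?_
  have hb : IsOpen (Metric.closedBall (0 : F) 1) :=
    IsUltrametricDist.isOpen_closedBall _ one_ne_zero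
  exact (hb.preimage (Units.continuous_val.matrix_elem i j)).inter
    (hb.preimage ((Units.continuous_val.comp continuous_inv).matrix_elem i j))

/-- The union of the cosets `GL_2(𝓞_F) * upper α β x` over `x ∈ X`. -/
def cell (α β : Fˣ) (X : Set F) : Set (Matrix.GeneralLinearGroup (Fin 2) F) :=
  {h | ∃ x ∈ X, h * (upper α β x)⁻¹ ∈ integralSubgroup F 2}

lemma isOpen_cell (α β : Fˣ) (X : Set F) : IsOpen (cell α β X) := by
  have : cell α β X = ⋃ x ∈ X, (fun h => h * (upper α β x)⁻¹) ⁻¹' integralGL 2 F := by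
    ext h; simp [cell, mem_integralSubgroup]
  rw [this]
  exact isOpen_biUnion fun x _ => (isOpen_integralGL 2).preimage (continuous_mul_const _)

end IntegralSubgroup

/-! ### Triviality of the modular character on upper triangular matrices -/

section Unimodular

variable {F : Type*} [NormedField F] [LocallyCompactSpace F]

-- Right translation by a central element is also a left translation, which preserves Haar measure.
open Measure in
lemma modularCharacter_of_central {G : Type*} [TopologicalSpace G] [Group G] [IsTopologicalGroup G]
    [LocallyCompactSpace G] (z : G) (hz : ∀ g, g * z = z * g) : modularCharacter z = 1 := by
  borelize G
  have h1 : modularCharacter z = modularCharacterFun z := rfl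
  rw [h1, modularCharacterFun_eq_haarScalarFactor haar]
  have : map (fun g => g * z) (haar : Measure G) = haar := by
    rw [show (fun g => g * z) = (fun g => z * g) from funext hz, map_mul_left_eq_self]
  simp only [this, haarScalarFactor_self]

instance : LocallyCompactSpace (Matrix (Fin 2) (Fin 2) F) :=
  inferInstanceAs (LocallyCompactSpace (Fin 2 → Fin 2 → F))

-- Conjugation by `diag(2, 1)` squares a unipotent element, so its modulus equals its own square.
-- The Weyl element exchanges `diag(α, β)` and `diag(β, α)`, whose product is scalar, so the modulus
-- of either squares to 1.
open Measure in
lemma modularCharacter_upper (h2 : (2 : F) ≠ 0) (α β : Fˣ) (x : F) :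
    modularCharacter (upper α β x) = 1 := by
  have hpos : ∀ g : Matrix.GeneralLinearGroup (Fin 2) F, modularCharacter g ≠ 0 := fun g =>
    (modularCharacterFun_pos g).ne'
  have hu : ∀ y : F, modularCharacter (upper (1 : Fˣ) 1 y) = 1 := by
    intro y
    have e1 : upper (Units.mk0 2 h2) 1 0 * upper 1 1 y =
        (upper 1 1 y * upper 1 1 y) * upper (Units.mk0 2 h2) 1 0 := by
      simp only [upper_mul]
      congr 1 <;> simp [two_mul]
    have e2 := congrArg modularCharacter e1
    simp only [map_mul] at e2
    have h3 := hpos (upper 1 1 y)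
    have h4 := hpos (upper (Units.mk0 2 h2) 1 0)
    have h5 : modularCharacter (upper (1 : Fˣ) 1 y) * 1 =
        modularCharacter (upper (1 : Fˣ) 1 y) * modularCharacter (upper (1 : Fˣ) 1 y) := by
      apply mul_right_cancel₀ h4
      rw [← e2]; ring
    exact (mul_left_cancel₀ h3 h5).symm
  let s : Matrix.GeneralLinearGroup (Fin 2) F :=
    ⟨!![0, 1; 1, 0], !![0, 1; 1, 0], by simp [Matrix.one_fin_two], by simp [Matrix.one_fin_two]⟩
  have hd : modularCharacter (upper α β 0) = 1 := by
    have e1 : s * upper α β 0 = upper β α 0 * s := by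
      apply Units.ext
      simp [s, coe_upper]
    have e2 := congrArg modularCharacter e1
    rw [map_mul, map_mul, mul_comm] at e2
    have e3 := mul_right_cancel₀ (hpos s) e2
    have e4 : modularCharacter (upper α β 0 * upper β α 0) = 1 := by
      apply modularCharacter_of_central
      intro g
      rw [upper_mul]
      apply Units.ext
      rw [Units.val_mul, Units.val_mul, coe_upper]
      ext i j
      fin_cases i <;> fin_cases j <;> simp [Matrix.mul_apply, Fin.sum_univ_two] <;> ring
    rw [map_mul, ← e3, ← pow_two] at e4
    exact (pow_eq_one_iff_of_nonneg zero_le two_ne_zero).1 e4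
  have : upper α β x = upper 1 1 (x * (β : F)⁻¹) * upper α β 0 := by
    rw [upper_mul]; congr 1 <;> simp
  rw [this, map_mul, hu, hd, one_mul]

-- No regularity of `μ` is assumed, and uniqueness of Haar measure then holds on open sets; the
-- cells below are open.
open Measure in
lemma measure_preimage_mul_upper (h2 : (2 : F) ≠ 0)
    [MeasurableSpace (Matrix.GeneralLinearGroup (Fin 2) F)]
    [BorelSpace (Matrix.GeneralLinearGroup (Fin 2) F)]
    (μ : Measure (Matrix.GeneralLinearGroup (Fin 2) F)) [μ.IsHaarMeasure]
    (α β : Fˣ) (x : F) {A : Set (Matrix.GeneralLinearGroup (Fin 2) F)} (hA : IsOpen A) :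
    μ ((fun g => g * upper α β x) ⁻¹' A) = μ A := by
  have h1 : modularCharacterFun (upper α β x) = 1 := modularCharacter_upper h2 α β x
  rw [modularCharacterFun_eq_haarScalarFactor μ] at h1
  have h3 := measure_isHaarMeasure_eq_smul_of_isOpen (map (· * upper α β x) μ) μ hA
  rw [h1, one_smul, map_apply (measurable_mul_const _) hA.measurableSet] at h3
  exact h3

end Unimodular

/-! ### Powers of the uniformizer and the Iwasawa decomposition -/

section Cells

variable {F : Type*} [NormedField F]

lemma IsUniformizer.norm_pos {ϖ : F} (h : IsUniformizer ϖ) : 0 < ‖ϖ‖ := norm_pos_iff.2 h.1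

lemma IsUniformizer.zpow_le_zpow {ϖ : F} (h : IsUniformizer ϖ) {i j : ℤ} :
    ‖ϖ‖ ^ i ≤ ‖ϖ‖ ^ j ↔ j ≤ i :=
  zpow_le_zpow_iff_right_of_lt_one₀ h.norm_pos h.2.1

lemma IsUniformizer.zpow_lt_zpow {ϖ : F} (h : IsUniformizer ϖ) {i j : ℤ} :
    ‖ϖ‖ ^ i < ‖ϖ‖ ^ j ↔ j < i :=
  zpow_lt_zpow_iff_right_of_lt_one₀ h.norm_pos h.2.1

lemma IsUniformizer.zpow_inj {ϖ : F} (h : IsUniformizer ϖ) {i j : ℤ} :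
    ‖ϖ‖ ^ i = ‖ϖ‖ ^ j ↔ i = j :=
  (zpow_right_injective₀ h.norm_pos h.2.1.ne).eq_iff

/-- A uniformizer as a unit of the field. -/
def IsUniformizer.unit {ϖ : F} (h : IsUniformizer ϖ) : Fˣ := Units.mk0 ϖ h.1

@[simp] lemma IsUniformizer.coe_unit {ϖ : F} (h : IsUniformizer ϖ) : (h.unit : F) = ϖ := rfl

lemma IsUniformizer.coe_unit_zpow {ϖ : F} (h : IsUniformizer ϖ) (k : ℤ) :
    ((h.unit ^ k : Fˣ) : F) = ϖ ^ k := by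
  rw [Units.val_zpow_eq_zpow_val]; rfl

/-- A norm strictly between consecutive powers of `‖ϖ‖` would rescale to one strictly between `‖ϖ‖`
and 1. -/
lemma IsUniformizer.exists_norm_eq_zpow {ϖ : F} (h : IsUniformizer ϖ) {x : F} (hx : x ≠ 0) :
    ∃ k : ℤ, ‖x‖ = ‖ϖ‖ ^ k := by
  obtain ⟨k, hk1, hk2⟩ := exists_mem_Ioc_zpow (norm_pos_iff.2 hx) (one_lt_inv₀ h.norm_pos |>.2 h.2.1)
  refine ⟨-(k + 1), ?_⟩
  rw [inv_zpow'] at hk1 hk2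
  by_contra hne
  have hlt : ‖x‖ < ‖ϖ‖ ^ (-(k + 1)) := lt_of_le_of_ne hk2 hne
  have h0 : ϖ ≠ 0 := h.1
  have h1 : ‖x * ϖ ^ (k + 1)‖ < 1 := by
    rw [norm_mul, norm_zpow]
    calc ‖x‖ * ‖ϖ‖ ^ (k + 1) < ‖ϖ‖ ^ (-(k + 1)) * ‖ϖ‖ ^ (k + 1) :=
          mul_lt_mul_of_pos_right hlt (zpow_pos h.norm_pos _)
      _ = 1 := by rw [← zpow_add₀ h.norm_pos.ne']; simp
  have h2 := h.2.2 _ h1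
  rw [norm_mul, norm_zpow, zpow_add_one₀ h.norm_pos.ne', ← mul_assoc] at h2
  have h3 : ‖x‖ * ‖ϖ‖ ^ k ≤ 1 := le_of_mul_le_mul_right (by rwa [one_mul]) h.norm_pos
  have h4 : ‖ϖ‖ ^ (-k) * ‖ϖ‖ ^ k < ‖x‖ * ‖ϖ‖ ^ k :=
    mul_lt_mul_of_pos_right hk1 (zpow_pos h.norm_pos _)
  rw [← zpow_add₀ h.norm_pos.ne'] at h4
  simp at h4
  linarith

variable [IsUltrametricDist F]

/-- The Iwasawa decomposition of `GL_2`. -/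
lemma exists_mul_upper {ϖ : F} (hϖ : IsUniformizer ϖ) (h : Matrix.GeneralLinearGroup (Fin 2) F) :
    ∃ k ∈ integralSubgroup F 2, ∃ (m n : ℤ) (x : F),
      h = k * upper (hϖ.unit ^ m) (hϖ.unit ^ n) x := by
  have step : ∀ g : Matrix.GeneralLinearGroup (Fin 2) F, g.val 1 0 = 0 →
      ∃ k ∈ integralSubgroup F 2, ∃ (m n : ℤ) (x : F),
      g = k * upper (hϖ.unit ^ m) (hϖ.unit ^ n) x := by
    intro g hg
    have hdet : g.val 0 0 * g.val 1 1 ≠ 0 := by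
      have := (Matrix.GeneralLinearGroup.det g).ne_zero
      rw [Matrix.GeneralLinearGroup.val_det_apply, Matrix.det_fin_two, hg] at this
      simpa using this
    obtain ⟨h0, h1⟩ := mul_ne_zero_iff.1 hdet
    obtain ⟨m, hm⟩ := hϖ.exists_norm_eq_zpow h0
    obtain ⟨n, hn⟩ := hϖ.exists_norm_eq_zpow h1
    refine ⟨upper (Units.mk0 _ h0 * hϖ.unit ^ (-m)) (Units.mk0 _ h1 * hϖ.unit ^ (-n)) 0, ?_, m, n,
      g.val 0 1 * (g.val 0 0)⁻¹ * ϖ ^ m, ?_⟩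
    · rw [mem_integralSubgroup, upper_mem_integralGL]
      simp [hm, hn, norm_zpow, mul_inv_cancel₀ (zpow_pos hϖ.norm_pos _).ne']
    · rw [upper_mul]
      apply Units.ext
      rw [coe_upper]
      have h3 : ϖ ^ m ≠ 0 := zpow_ne_zero _ hϖ.1
      ext i j
      fin_cases i <;> fin_cases j <;> simp [hg]
      field_simp
  have step2 : ∀ k : Matrix.GeneralLinearGroup (Fin 2) F, k ∈ integralSubgroup F 2 →
      (k * h).val 1 0 = 0 → ∃ k ∈ integralSubgroup F 2, ∃ (m n : ℤ) (x : F),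
      h = k * upper (hϖ.unit ^ m) (hϖ.unit ^ n) x := by
    intro k hk h0
    obtain ⟨k', hk', m, n, x, e⟩ := step _ h0
    exact ⟨k⁻¹ * k', mul_mem (inv_mem hk) hk', m, n, x, by rw [mul_assoc, ← e]; group⟩
  have hdet : h.val 0 0 * h.val 1 1 - h.val 0 1 * h.val 1 0 ≠ 0 := by
    have := (Matrix.GeneralLinearGroup.det h).ne_zero
    rwa [Matrix.GeneralLinearGroup.val_det_apply, Matrix.det_fin_two] at this
  -- The larger entry of the first column is the pivot, so that the row operation clearing the other
  -- entry is integral.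
  rcases le_total ‖h.val 1 0‖ ‖h.val 0 0‖ with hle | hle
  · have hp : h.val 0 0 ≠ 0 := by
      intro h0
      rw [h0, norm_zero, norm_le_zero_iff] at hle
      simp [h0, hle] at hdet
    have hb : ‖h.val 1 0‖ / ‖h.val 0 0‖ ≤ 1 := div_le_one_of_le₀ hle (norm_nonneg _)
    refine step2 ⟨!![1, 0; -(h.val 1 0 / h.val 0 0), 1], !![1, 0; h.val 1 0 / h.val 0 0, 1],
      by simp [Matrix.one_fin_two], by simp [Matrix.one_fin_two]⟩ ?_ ?_
    · intro i j
      rw [Units.inv_mk]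
      fin_cases i <;> fin_cases j <;> simp [hb]
    · simp [Matrix.mul_apply, Fin.sum_univ_two, hp]
  · have hp : h.val 1 0 ≠ 0 := by
      intro h0
      rw [h0, norm_zero, norm_le_zero_iff] at hle
      simp [h0, hle] at hdet
    have hb : ‖h.val 0 0‖ / ‖h.val 1 0‖ ≤ 1 := div_le_one_of_le₀ hle (norm_nonneg _)
    refine step2 ⟨!![0, 1; 1, -(h.val 0 0 / h.val 1 0)], !![h.val 0 0 / h.val 1 0, 1; 1, 0],
      by simp [Matrix.one_fin_two], by simp [Matrix.one_fin_two]⟩ ?_ ?_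
    · intro i j
      rw [Units.inv_mk]
      fin_cases i <;> fin_cases j <;> simp [hb]
    · simp [Matrix.mul_apply, Fin.sum_univ_two, hp]

/-- For equal exponents the quotient is the unipotent matrix with entry `(x - x') / ϖ ^ n`. Hence
`m`, `n` and `x` modulo `ϖ ^ n` classify the cosets. -/
lemma upper_mul_inv_mem_iff {ϖ : F} (hϖ : IsUniformizer ϖ) {m n m' n' : ℤ} {x x' : F} :
    upper (hϖ.unit ^ m) (hϖ.unit ^ n) x * (upper (hϖ.unit ^ m') (hϖ.unit ^ n') x')⁻¹ ∈
      integralSubgroup F 2 ↔ m = m' ∧ n = n' ∧ ‖x - x'‖ ≤ ‖ϖ‖ ^ n := by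
  rw [upper_inv, upper_mul, mem_integralSubgroup, upper_mem_integralGL]
  have e1 : ∀ i j : ℤ, ‖((hϖ.unit ^ i * (hϖ.unit ^ j)⁻¹ : Fˣ) : F)‖ = 1 ↔ i = j := by
    intro i j
    rw [← zpow_neg, ← zpow_add, hϖ.coe_unit_zpow, norm_zpow, ← zpow_zero ‖ϖ‖, hϖ.zpow_inj]
    omega
  rw [e1, e1]
  refine and_congr_right fun hm => and_congr_right fun hn => ?_
  subst hm hn
  have h0 : ϖ ≠ 0 := hϖ.1
  have e2 : ((hϖ.unit ^ m : Fˣ) : F) * -(((hϖ.unit ^ m : Fˣ) : F)⁻¹ * x' *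
      ((hϖ.unit ^ n : Fˣ) : F)⁻¹) + x * (((hϖ.unit ^ n)⁻¹ : Fˣ) : F) = (x - x') / ϖ ^ n := by
    rw [← zpow_neg, hϖ.coe_unit_zpow, hϖ.coe_unit_zpow, hϖ.coe_unit_zpow, zpow_neg]
    have h3 : ϖ ^ m ≠ 0 := zpow_ne_zero _ hϖ.1
    field_simp; ring
  rw [e2, norm_div, norm_zpow, div_le_one (zpow_pos hϖ.norm_pos _)]

lemma mul_upper_mem_cell_iff {ϖ : F} (hϖ : IsUniformizer ϖ) {m n m' n' : ℤ} {x : F} {X : Set F}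
    (hX : ∀ y y', ‖y - y'‖ ≤ ‖ϖ‖ ^ n' → (y ∈ X ↔ y' ∈ X))
    {k : Matrix.GeneralLinearGroup (Fin 2) F} (hk : k ∈ integralSubgroup F 2) :
    k * upper (hϖ.unit ^ m) (hϖ.unit ^ n) x ∈ cell (hϖ.unit ^ m') (hϖ.unit ^ n') X ↔
      m = m' ∧ n = n' ∧ x ∈ X := by
  simp only [cell, Set.mem_ofPred_eq, mul_assoc, (integralSubgroup F 2).mul_mem_cancel_left hk,
    upper_mul_inv_mem_iff]
  constructor
  · rintro ⟨y, hy, rfl, rfl, h⟩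
    exact ⟨rfl, rfl, (hX _ _ h).2 hy⟩
  · rintro ⟨rfl, rfl, h⟩
    exact ⟨x, h, rfl, rfl, by simpa using (zpow_pos hϖ.norm_pos _).le⟩

lemma mem_cell_one {X : Set F} {h : Matrix.GeneralLinearGroup (Fin 2) F} :
    h ∈ cell 1 1 X ↔ ∃ x ∈ X, h * upper 1 1 (-x) ∈ integralSubgroup F 2 := by
  simp [cell, upper_inv]

omit [IsUltrametricDist F] in
lemma unipotent_mul (x y : F) : upper (1 : Fˣ) 1 x * upper 1 1 y = upper 1 1 (x + y) := by
  rw [upper_mul]; congr 1 <;> simp [add_comm]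

lemma unipotent_mem_integralSubgroup {x : F} :
    upper 1 1 x ∈ integralSubgroup F 2 ↔ ‖x‖ ≤ 1 := by
  simp [mem_integralSubgroup, upper_mem_integralGL]

end Cells

/-! ### Residue representatives and volumes of cells -/

section Volume

variable {F : Type*} [NormedField F] [IsUltrametricDist F]

lemma residue_eq_residue_iff (x y : (NormedField.valuation (K := F)).valuationSubring) :
    IsLocalRing.residue _ x = IsLocalRing.residue _ y ↔ ‖(x : F) - y‖ < 1 := by
  have hmem : ∀ x : F, x ∈ (NormedField.valuation (K := F)).valuationSubring ↔ ‖x‖ ≤ 1 :=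
    fun x => Iff.rfl
  rw [← sub_eq_zero, ← map_sub, IsLocalRing.residue_eq_zero_iff, IsLocalRing.mem_maximalIdeal,
    mem_nonunits_iff]
  generalize hz : x - y = z
  have hz' : (x : F) - y = z := by rw [← hz]; rfl
  rw [hz', ← not_le, not_iff_not]
  constructor
  · intro hu
    obtain ⟨u, hu⟩ := hu.exists_right_inv
    have h1 : (z : F) * u = 1 := congrArg Subtype.val hu
    have h2 : ‖(z : F)‖ * ‖(u : F)‖ = 1 := by rw [← norm_mul, h1, norm_one]
    nlinarith [(hmem _).1 u.2, norm_nonneg (z : F)]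
  · intro h1
    have h0 : (z : F) ≠ 0 := fun h0 => by simp [h0] at h1; linarith
    have h2 : ‖(z : F)⁻¹‖ ≤ 1 := by rw [norm_inv]; exact inv_le_one_of_one_le₀ h1
    exact IsUnit.of_mul_eq_one ⟨(z : F)⁻¹, (hmem _).2 h2⟩ (Subtype.ext (mul_inv_cancel₀ h0))

instance [ProperSpace F] :
    Finite (IsLocalRing.ResidueField (NormedField.valuation (K := F)).valuationSubring) := by
  obtain ⟨t, hts, htf, hcov⟩ := (isCompact_closedBall (0 : F) 1).finite_cover_balls one_pos
  have : Finite t := htf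
  let f : t → IsLocalRing.ResidueField (NormedField.valuation (K := F)).valuationSubring :=
    fun x => IsLocalRing.residue _ ⟨x, mem_closedBall_zero_iff.1 (hts x.2)⟩
  refine Finite.of_surjective f fun y => ?_
  obtain ⟨x, rfl⟩ := IsLocalRing.residue_surjective y
  have hx : (x : F) ∈ Metric.closedBall (0 : F) 1 := mem_closedBall_zero_iff.2 x.2
  obtain ⟨z, hz, hxz⟩ := Set.mem_iUnion₂.1 (hcov hx)
  refine ⟨⟨z, hz⟩, ?_⟩
  rw [residue_eq_residue_iff, norm_sub_rev, ← dist_eq_norm]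
  exact hxz

lemma exists_residue_representatives [ProperSpace F] {ϖ : F} (hϖ : IsUniformizer ϖ) :
    ∃ R : Finset F, R.card = residueCard F ∧ (∀ x ∈ R, ‖x‖ ≤ 1) ∧
      (∀ x ∈ R, ∀ y ∈ R, ‖x - y‖ ≤ ‖ϖ‖ → x = y) ∧ ∀ x, ‖x‖ ≤ 1 → ∃ y ∈ R, ‖x - y‖ ≤ ‖ϖ‖ := by
  classical
  let 𝓞 := (NormedField.valuation (K := F)).valuationSubring
  have hmem : ∀ x : F, x ∈ 𝓞 ↔ ‖x‖ ≤ 1 := fun x => Iff.rfl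
  have hres : ∀ x y : 𝓞, IsLocalRing.residue 𝓞 x = IsLocalRing.residue 𝓞 y ↔
      ‖(x : F) - y‖ ≤ ‖ϖ‖ := fun x y =>
    (residue_eq_residue_iff x y).trans ⟨hϖ.2.2 _, fun h => h.trans_lt hϖ.2.1⟩
  have : Fintype (IsLocalRing.ResidueField 𝓞) := Fintype.ofFinite _
  obtain ⟨f, hf⟩ := (IsLocalRing.residue_surjective (R := 𝓞)).hasRightInverse
  refine ⟨Finset.univ.image fun t => (f t : F), ?_, ?_, ?_, ?_⟩
  · rw [Finset.card_image_of_injective _ fun s t hst => hf.injective (Subtype.val_injective hst),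
      Finset.card_univ, residueCard, Nat.card_eq_fintype_card]
  · simp only [Finset.mem_image, Finset.mem_univ, true_and, forall_exists_index,
      forall_apply_eq_imp_iff]
    exact fun t => (hmem _).1 (f t).2
  · simp only [Finset.mem_image, Finset.mem_univ, true_and, forall_exists_index,
      forall_apply_eq_imp_iff]
    intro s t hst
    rw [← hres, hf, hf] at hst
    rw [hst]
  · intro x hx
    refine ⟨f (IsLocalRing.residue 𝓞 ⟨x, hx⟩), by simp, ?_⟩
    rw [← hres ⟨x, hx⟩, hf]

lemma one_lt_residueCard [ProperSpace F] : 1 < residueCard F := by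
  rw [residueCard, Finite.one_lt_card_iff_nontrivial]
  infer_instance

variable [MeasurableSpace (Matrix.GeneralLinearGroup (Fin 2) F)]
    [BorelSpace (Matrix.GeneralLinearGroup (Fin 2) F)]
    (μ : Measure (Matrix.GeneralLinearGroup (Fin 2) F)) [μ.IsHaarMeasure]

/-- Enlarging the ball by one power of `ϖ` splits it into `q` translates of the previous ball, by `s
* T` with `T = ϖ ^ (-(j + 1))` and `s` running over residue representatives. The corresponding cells
are disjoint and have equal volume by right invariance. -/
lemma measure_cell_unipotent [ProperSpace F] (h2 : (2 : F) ≠ 0) {ϖ : F} (hϖ : IsUniformizer ϖ)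
    (hμ : μ (integralGL 2 F) = 1) (j : ℕ) :
    μ (cell 1 1 {y : F | ‖y‖ ≤ ‖ϖ‖ ^ (-j : ℤ)}) = (residueCard F : ENNReal) ^ j := by
  induction j with
  | zero =>
    rw [pow_zero, ← hμ]
    congr 1
    ext h
    rw [mem_cell_one, ← mem_integralSubgroup]
    simp only [Set.mem_ofPred_eq, Nat.cast_zero, neg_zero, zpow_zero]
    constructor
    · rintro ⟨y, hy, hk⟩
      rwa [(integralSubgroup F 2).mul_mem_cancel_right
        (unipotent_mem_integralSubgroup.2 (by rwa [norm_neg]))] at hk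
    · intro hh
      exact ⟨0, by simp, by simpa [upper_one] using hh⟩
  | succ j ih =>
    obtain ⟨R, hR, hR1, hR2, hR3⟩ := exists_residue_representatives hϖ
    obtain ⟨T, hT, hj, hj'⟩ : ∃ T : F, T ≠ 0 ∧
        (∀ z : F, ‖z * T‖ ≤ ‖ϖ‖ ^ (-j : ℤ) ↔ ‖z‖ ≤ ‖ϖ‖) ∧
        ∀ z : F, ‖z * T‖ ≤ ‖ϖ‖ ^ (-(j + 1 : ℕ) : ℤ) ↔ ‖z‖ ≤ 1 := by
      refine ⟨ϖ ^ (-(j + 1 : ℕ) : ℤ), zpow_ne_zero _ hϖ.1, fun z => ?_, fun z => ?_⟩ <;>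
      · rw [norm_mul, norm_zpow, ← le_div_iff₀ (zpow_pos hϖ.norm_pos _),
          ← zpow_sub₀ hϖ.norm_pos.ne']
        simp
    have hle : ‖ϖ‖ ^ (-j : ℤ) ≤ ‖ϖ‖ ^ (-(j + 1 : ℕ) : ℤ) := hϖ.zpow_le_zpow.2 (by push_cast; omega)
    have key : cell 1 1 {y : F | ‖y‖ ≤ ‖ϖ‖ ^ (-(j + 1 : ℕ) : ℤ)} =
        ⋃ s ∈ R, (fun g => g * upper 1 1 (-(s * T))) ⁻¹'
          cell 1 1 {y : F | ‖y‖ ≤ ‖ϖ‖ ^ (-j : ℤ)} := by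
      ext h
      simp only [Set.mem_iUnion, Set.mem_preimage, exists_prop, mem_cell_one, mul_assoc,
        unipotent_mul, Set.mem_ofPred_eq]
      constructor
      · rintro ⟨y, hy, hk⟩
        obtain ⟨s, hs, hys⟩ := hR3 (y * T⁻¹) (by rwa [← hj', inv_mul_cancel_right₀ hT])
        refine ⟨s, hs, y - s * T, ?_, ?_⟩
        · rwa [← hj, sub_mul, inv_mul_cancel_right₀ hT] at hys
        · rwa [show -(s * T) + -(y - s * T) = -y by ring]
      · rintro ⟨s, hs, y, hy, hk⟩
        refine ⟨y + s * T, ?_, ?_⟩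
        · exact (IsUltrametricDist.norm_add_le_max _ _).trans
            (max_le (hy.trans hle) ((hj' s).2 (hR1 s hs)))
        · rwa [show -(y + s * T) = -(s * T) + -y by ring]
    rw [key, measure_biUnion_finset]
    · have : ∀ s ∈ R, μ ((fun g => g * upper 1 1 (-(s * T))) ⁻¹'
          cell 1 1 {y : F | ‖y‖ ≤ ‖ϖ‖ ^ (-j : ℤ)}) = (residueCard F : ENNReal) ^ j := fun s _ => by
        rw [measure_preimage_mul_upper h2 μ _ _ _ (isOpen_cell _ _ _), ih]
      rw [Finset.sum_congr rfl this, Finset.sum_const, hR, nsmul_eq_mul, pow_succ, mul_comm]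
    · intro s hs t ht hst
      refine Set.disjoint_left.2 fun h h1 h2 => hst (hR2 s hs t ht ?_)
      simp only [mem_cell_one, Set.mem_preimage, mul_assoc, unipotent_mul,
        Set.mem_ofPred_eq] at h1 h2
      obtain ⟨y, hy, hk⟩ := h1
      obtain ⟨y', hy', hk'⟩ := h2
      have h3 := mul_mem (inv_mem hk) hk'
      rw [mul_inv_rev, mul_assoc, inv_mul_cancel_left, upper_inv] at h3
      simp only [inv_one, Units.val_one, one_mul, mul_one, unipotent_mul,
        unipotent_mem_integralSubgroup] at h3
      have h4 : ‖(1 : F)‖ ≤ ‖ϖ‖ ^ (-j : ℤ) := by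
        rw [norm_one, ← zpow_zero ‖ϖ‖]; exact hϖ.zpow_le_zpow.2 (by omega)
      rw [norm_one] at h4
      rw [← hj, show (s - t) * T = (-(-(s * T) + -y) + (-(t * T) + -y')) + (y' + -y) by ring]
      refine (IsUltrametricDist.norm_add_le_max _ _).trans (max_le (h3.trans h4) ?_)
      exact (IsUltrametricDist.norm_add_le_max _ _).trans (max_le hy' (by rwa [norm_neg]))
    · exact fun s _ => ((isOpen_cell _ _ _).preimage (continuous_mul_const _)).measurableSet

lemma measure_cell_ball [ProperSpace F] (h2 : (2 : F) ≠ 0) {ϖ : F} (hϖ : IsUniformizer ϖ)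
    (hμ : μ (integralGL 2 F) = 1) (m n : ℤ) (j : ℕ) (x₀ : F) :
    μ (cell (hϖ.unit ^ m) (hϖ.unit ^ n) {x | ‖x - x₀‖ ≤ ‖ϖ‖ ^ (n - j)}) =
      (residueCard F : ENNReal) ^ j := by
  rw [← measure_cell_unipotent μ h2 hϖ hμ j, ← measure_preimage_mul_upper h2 μ
    (hϖ.unit ^ m) (hϖ.unit ^ n) x₀ (isOpen_cell _ _ _)]
  congr 1
  have h0 : ϖ ^ n ≠ 0 := zpow_ne_zero _ hϖ.1
  have hu : ∀ y : F, upper (hϖ.unit ^ m) (hϖ.unit ^ n) x₀ *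
      (upper (hϖ.unit ^ m) (hϖ.unit ^ n) (x₀ + y * ϖ ^ n))⁻¹ = upper 1 1 (-y) := by
    intro y
    rw [mul_inv_eq_iff_eq_mul, upper_mul]
    congr 1 <;> simp [hϖ.coe_unit_zpow]
  have hn : ∀ y : F, ‖y * ϖ ^ n‖ ≤ ‖ϖ‖ ^ (n - j) ↔ ‖y‖ ≤ ‖ϖ‖ ^ (-j : ℤ) := by
    intro y
    rw [norm_mul, norm_zpow, ← le_div_iff₀ (zpow_pos hϖ.norm_pos _), ← zpow_sub₀ hϖ.norm_pos.ne']
    simp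
  ext h
  rw [mem_cell_one]
  simp only [cell, Set.mem_preimage, Set.mem_ofPred_eq, mul_assoc]
  constructor
  · rintro ⟨x, hx, hk⟩
    have hx' : x₀ + (x - x₀) / ϖ ^ n * ϖ ^ n = x := by field_simp; ring
    refine ⟨(x - x₀) / ϖ ^ n, ?_, ?_⟩
    · rw [← hn, div_mul_cancel₀ _ h0]; exact hx
    · rw [← hu, hx']; exact hk
  · rintro ⟨y, hy, hk⟩
    exact ⟨x₀ + y * ϖ ^ n, by rwa [add_sub_cancel_left, hn], by rwa [hu]⟩

end Volume

/-! ### Splitting the quadratic `1 + τ z - κ z ^ 2` -/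

section Roots

variable {F : Type*} [NormedField F] [IsUltrametricDist F]

lemma norm_add_eq_of_lt {x y : F} (h : ‖x‖ < ‖y‖) : ‖x + y‖ = ‖y‖ := by
  rw [IsUltrametricDist.norm_add_eq_max_of_norm_ne_norm h.ne, max_eq_right h.le]

lemma norm_sub_eq_of_lt {x y : F} (h : ‖x‖ < ‖y‖) : ‖x - y‖ = ‖y‖ := by
  rw [sub_eq_add_neg, norm_add_eq_of_lt (by rwa [norm_neg]), norm_neg]

lemma norm_sub_eq_of_lt' {x y : F} (h : ‖y‖ < ‖x‖) : ‖x - y‖ = ‖x‖ := by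
  rw [norm_sub_rev, norm_sub_eq_of_lt h]

/-- If `‖κ‖ < ‖τ‖ ^ 2` then `1 + τ z - κ z ^ 2` has a root of absolute value `‖τ‖⁻¹`. -/
lemma exists_root_of_norm_lt [CompleteSpace F] {κ τ : F} (h : ‖κ‖ < ‖τ‖ ^ 2) :
    ∃ z : F, ‖z‖ = ‖τ‖⁻¹ ∧ 1 + τ * z - κ * z ^ 2 = 0 := by
  have hτ : τ ≠ 0 := fun h0 => by
    rw [h0] at h; simp at h; linarith [norm_nonneg κ]
  have hτ' : 0 < ‖τ‖ := norm_pos_iff.2 hτ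
  -- The equation is solved for its linear term; the resulting map contracts the ball of radius
  -- `‖τ‖⁻¹` by the factor `‖κ‖ / ‖τ‖ ^ 2 < 1`. No square root of the discriminant is needed.
  let f : F → F := fun z => (κ * z ^ 2 - 1) / τ
  let s : Set F := Metric.closedBall 0 ‖τ‖⁻¹
  have hsq : ∀ z, ‖z‖ ≤ ‖τ‖⁻¹ → ‖κ * z ^ 2‖ < 1 := by
    intro z hz
    rw [norm_mul, norm_pow]
    calc ‖κ‖ * ‖z‖ ^ 2 ≤ ‖κ‖ * ‖τ‖⁻¹ ^ 2 := by gcongr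
      _ < ‖τ‖ ^ 2 * ‖τ‖⁻¹ ^ 2 := by gcongr
      _ = 1 := by rw [← mul_pow, mul_inv_cancel₀ hτ'.ne', one_pow]
  have hnorm : ∀ z, ‖z‖ ≤ ‖τ‖⁻¹ → ‖f z‖ = ‖τ‖⁻¹ := by
    intro z hz
    have := norm_sub_eq_of_lt (x := κ * z ^ 2) (y := (1 : F)) (by rw [norm_one]; exact hsq z hz)
    rw [norm_div, this, norm_one, one_div]
  have hs : Set.MapsTo f s s := fun z hz => by
    rw [mem_closedBall_zero_iff] at hz ⊢
    exact (hnorm z hz).le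
  have hK : ‖κ‖ / ‖τ‖ ^ 2 < 1 := (div_lt_one (by positivity)).2 h
  have hcontr : ContractingWith ⟨‖κ‖ / ‖τ‖ ^ 2, by positivity⟩ (hs.restrict f s s) := by
    refine ⟨by exact_mod_cast hK, LipschitzWith.of_dist_le_mul fun x y => ?_⟩
    have hx := mem_closedBall_zero_iff.1 x.2
    have hy := mem_closedBall_zero_iff.1 y.2
    rw [Subtype.dist_eq, Subtype.dist_eq, dist_eq_norm, dist_eq_norm]
    simp only [Set.MapsTo.val_restrict_apply, f]
    have e : (κ * (x : F) ^ 2 - 1) / τ - (κ * (y : F) ^ 2 - 1) / τ =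
        κ / τ * ((x + y) * (x - y)) := by ring
    rw [e, norm_mul, norm_mul, norm_div]
    have h1 : ‖(x : F) + y‖ ≤ ‖τ‖⁻¹ :=
      (IsUltrametricDist.norm_add_le_max _ _).trans (max_le hx hy)
    change _ ≤ ‖κ‖ / ‖τ‖ ^ 2 * _
    calc ‖κ‖ / ‖τ‖ * (‖(x : F) + y‖ * ‖(x : F) - y‖)
        ≤ ‖κ‖ / ‖τ‖ * (‖τ‖⁻¹ * ‖(x : F) - y‖) := by gcongr
      _ = ‖κ‖ / ‖τ‖ ^ 2 * ‖(x : F) - y‖ := by field_simp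
  obtain ⟨z, hz, hfix, -⟩ := hcontr.exists_fixedPoint' Metric.isClosed_closedBall.isComplete hs
    (x := 0) (by simp [s]) (edist_ne_top _ _)
  refine ⟨z, ?_, ?_⟩
  · rw [← hnorm z (mem_closedBall_zero_iff.1 hz), hfix]
  · have : (κ * z ^ 2 - 1) / τ = z := hfix
    rw [div_eq_iff hτ] at this
    linear_combination -this

/-- The second root is `τ / κ - z₁` by Vieta; `τ / κ` dominates `z₁`, which fixes both remaining
norms. -/
lemma exists_factorization [CompleteSpace F] {κ τ : F} (hκ : κ ≠ 0) (h : ‖κ‖ < ‖τ‖ ^ 2) :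
    ∃ z₁ z₂ : F, ‖z₁‖ = ‖τ‖⁻¹ ∧ ‖z₂‖ = ‖τ‖ / ‖κ‖ ∧ ‖z₁ - z₂‖ = ‖τ‖ / ‖κ‖ ∧
      ∀ α x : F, α ^ 2 + τ * α * x - κ * x ^ 2 = -κ * ((x - α * z₁) * (x - α * z₂)) := by
  obtain ⟨z, hz, hroot⟩ := exists_root_of_norm_lt h
  have hκ' : 0 < ‖κ‖ := norm_pos_iff.2 hκ
  have hτ' : 0 < ‖τ‖ := by
    rcases (norm_nonneg τ).eq_or_lt with h0 | h0
    · rw [← h0] at h; simp at h; linarith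
    · exact h0
  have hlt : ‖z‖ < ‖τ / κ‖ := by
    rw [hz, norm_div, lt_div_iff₀ hκ', inv_mul_lt_iff₀ hτ', ← pow_two]; exact h
  have hz2 : ‖τ / κ - z‖ = ‖τ‖ / ‖κ‖ := by
    rw [norm_sub_eq_of_lt' hlt, norm_div]
  refine ⟨z, τ / κ - z, hz, hz2, ?_, fun α x => ?_⟩
  · rw [norm_sub_eq_of_lt (by rw [hz2, ← norm_div]; exact hlt), hz2]
  · field_simp
    linear_combination α ^ 2 * hroot

end Roots

/-! ### The shape of the admissible set -/

section Admissible

variable {F : Type*} [NormedField F] [IsUltrametricDist F]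

/-- The set of all `x` for which the matrix `upper (ϖ ^ m) (ϖ ^ n) x` contributes to the orbital
integral, when `b`, `c = κ b`, `d - a = τ b` have valuations `B`, `C` and `B + v(τ)`. -/
def admissible (ϖ κ τ : F) (r : ℕ) (B C m n : ℤ) : Set F :=
  {x | ‖x‖ ≤ 1 ∧ ‖x‖ ≤ ‖ϖ‖ ^ (m - C - r) ∧
    ‖(ϖ ^ m) ^ 2 + τ * ϖ ^ m * x - κ * x ^ 2‖ ≤ ‖ϖ‖ ^ (m + n - r - B)}

variable {ϖ κ τ : F} {r : ℕ} {B C : ℤ}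

/-- Serves both regimes: `D` is either `v(d - a)` or the stand-in `(B + C + 1) / 2`, and only a
lower bound for the valuation of `τ` enters. -/
lemma admissible_eq_ball (hϖ : IsUniformizer ϖ) (hκ : ‖κ‖ = ‖ϖ‖ ^ (C - B)) {D : ℤ}
    (hD : 2 * D ≤ B + C + 1) (hτ : ‖τ‖ ≤ ‖ϖ‖ ^ (D - B)) {n i : ℕ}
    (hi : (i : ℤ) ≤ 2 * (r + D)) (hi' : (i : ℤ) ≤ 2 * r + B + C) :
    admissible ϖ κ τ r B C (r + C + n - i) n =
      {x | ‖x - 0‖ ≤ ‖ϖ‖ ^ ((n : ℤ) - (min n (i / 2) : ℕ))} := by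
  obtain ⟨m, hm⟩ : ∃ m : ℤ, m = r + C + n - i := ⟨_, rfl⟩
  rw [← hm]
  have hp := hϖ.norm_pos
  have hα : ‖(ϖ ^ m) ^ 2‖ = ‖ϖ‖ ^ (2 * m) := by
    rw [norm_pow, norm_zpow, ← zpow_natCast, ← zpow_mul]; congr 1; push_cast; ring
  ext x
  simp only [admissible, Set.mem_ofPred_eq, sub_zero]
  constructor
  · rintro ⟨h1, -, h3⟩
    rcases eq_or_ne x 0 with rfl | hx
    · rw [norm_zero]; positivity
    obtain ⟨ξ, hξ⟩ := hϖ.exists_norm_eq_zpow hx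
    rw [hξ, hϖ.zpow_le_zpow]
    rw [hξ, ← zpow_zero ‖ϖ‖, hϖ.zpow_le_zpow] at h1
    -- Outside the ball `κ x ^ 2` strictly dominates the other two terms, so the quadratic is as
    -- large as `κ x ^ 2`, which is too large.
    by_contra hlt
    have e3 : ‖κ * x ^ 2‖ = ‖ϖ‖ ^ (C - B + 2 * ξ) := by
      rw [norm_mul, norm_pow, hκ, hξ, ← zpow_natCast, ← zpow_mul, ← zpow_add₀ hp.ne']
      congr 1; push_cast; ring
    have e2 : ‖τ * ϖ ^ m * x‖ ≤ ‖ϖ‖ ^ (D - B + m + ξ) := by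
      rw [norm_mul, norm_mul, norm_zpow, hξ, zpow_add₀ hp.ne', zpow_add₀ hp.ne']
      gcongr
    have e4 : ‖(ϖ ^ m) ^ 2 + τ * ϖ ^ m * x‖ < ‖κ * x ^ 2‖ := by
      refine (IsUltrametricDist.norm_add_le_max _ _).trans_lt (max_lt ?_ (e2.trans_lt ?_)) <;>
      · rw [e3]; try rw [hα]
        rw [hϖ.zpow_lt_zpow]
        omega
    rw [norm_sub_eq_of_lt e4, e3, hϖ.zpow_le_zpow] at h3
    omega
  · intro h
    refine ⟨h.trans ?_, h.trans ?_, ?_⟩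
    · rw [← zpow_zero ‖ϖ‖, hϖ.zpow_le_zpow]; omega
    · rw [hϖ.zpow_le_zpow]; omega
    · rw [sub_eq_add_neg]
      refine (IsUltrametricDist.norm_add_le_max _ _).trans (max_le
        ((IsUltrametricDist.norm_add_le_max _ _).trans (max_le ?_ ?_)) ?_)
      · rw [hα, hϖ.zpow_le_zpow]; omega
      · rw [norm_mul, norm_mul, norm_zpow]
        calc ‖τ‖ * ‖ϖ‖ ^ m * ‖x‖ ≤ ‖ϖ‖ ^ (D - B) * ‖ϖ‖ ^ m *
              ‖ϖ‖ ^ ((n : ℤ) - (min n (i / 2) : ℕ)) := by gcongr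
          _ = ‖ϖ‖ ^ (D - B + m + ((n : ℤ) - (min n (i / 2) : ℕ))) := by
            rw [zpow_add₀ hp.ne', zpow_add₀ hp.ne']
          _ ≤ _ := by rw [hϖ.zpow_le_zpow]; omega
      · rw [norm_neg, norm_mul, norm_pow, hκ]
        calc ‖ϖ‖ ^ (C - B) * ‖x‖ ^ 2 ≤ ‖ϖ‖ ^ (C - B) *
              (‖ϖ‖ ^ ((n : ℤ) - (min n (i / 2) : ℕ))) ^ 2 := by gcongr
          _ = ‖ϖ‖ ^ (C - B + 2 * ((n : ℤ) - (min n (i / 2) : ℕ))) := by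
            rw [← zpow_natCast, ← zpow_mul, ← zpow_add₀ hp.ne']
            congr 1; push_cast; ring
          _ ≤ _ := by rw [hϖ.zpow_le_zpow]; omega

/-- As `C - B` is odd, `α ^ 2` and `κ x ^ 2` never have equal valuation, and the linear term lies
above their average. Nothing cancels, so the quadratic is at least as large as `α ^ 2`, which
already exceeds the bound. -/
lemma admissible_eq_empty (hϖ : IsUniformizer ϖ) (hκ : ‖κ‖ = ‖ϖ‖ ^ (C - B)) {D : ℤ}
    (hD : 2 * D = B + C + 1) (hτ : ‖τ‖ ≤ ‖ϖ‖ ^ (D - B)) {n i : ℕ}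
    (hi : 2 * r + B + C < (i : ℤ)) :
    admissible ϖ κ τ r B C (r + C + n - i) n = ∅ := by
  obtain ⟨m, hm⟩ : ∃ m : ℤ, m = r + C + n - i := ⟨_, rfl⟩
  rw [← hm]
  have hp := hϖ.norm_pos
  have hα : ‖(ϖ ^ m) ^ 2‖ = ‖ϖ‖ ^ (2 * m) := by
    rw [norm_pow, norm_zpow, ← zpow_natCast, ← zpow_mul]; congr 1; push_cast; ring
  ext x
  simp only [admissible, Set.mem_ofPred_eq, Set.mem_empty_iff_false, iff_false]
  rintro ⟨-, -, h3⟩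
  rcases eq_or_ne x 0 with rfl | hx
  · simp only [mul_zero, add_zero, ne_eq, OfNat.ofNat_ne_zero, not_false_eq_true, zero_pow,
      sub_zero] at h3
    rw [hα, hϖ.zpow_le_zpow] at h3
    omega
  obtain ⟨ξ, hξ⟩ := hϖ.exists_norm_eq_zpow hx
  have e3 : ‖κ * x ^ 2‖ = ‖ϖ‖ ^ (C - B + 2 * ξ) := by
    rw [norm_mul, norm_pow, hκ, hξ, ← zpow_natCast, ← zpow_mul, ← zpow_add₀ hp.ne']
    congr 1; push_cast; ring
  have e2 : ‖τ * ϖ ^ m * x‖ ≤ ‖ϖ‖ ^ (D - B + m + ξ) := by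
    rw [norm_mul, norm_mul, norm_zpow, hξ, zpow_add₀ hp.ne', zpow_add₀ hp.ne']
    gcongr
  rcases lt_or_ge (C + 2 * ξ) (B + 2 * m) with hlt | hge
  · have e4 : ‖(ϖ ^ m) ^ 2 + τ * ϖ ^ m * x‖ < ‖κ * x ^ 2‖ := by
      refine (IsUltrametricDist.norm_add_le_max _ _).trans_lt (max_lt ?_ (e2.trans_lt ?_)) <;>
      · rw [e3]; try rw [hα]
        rw [hϖ.zpow_lt_zpow]
        omega
    rw [norm_sub_eq_of_lt e4, e3, hϖ.zpow_le_zpow] at h3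
    omega
  · have e4 : ‖τ * ϖ ^ m * x - κ * x ^ 2‖ < ‖(ϖ ^ m) ^ 2‖ := by
      rw [sub_eq_add_neg]
      refine (IsUltrametricDist.norm_add_le_max _ _).trans_lt (max_lt (e2.trans_lt ?_) ?_)
      · rw [hα, hϖ.zpow_lt_zpow]; omega
      · rw [norm_neg, e3, hα, hϖ.zpow_lt_zpow]; omega
    rw [add_sub_assoc, add_comm, norm_add_eq_of_lt e4, hα, hϖ.zpow_le_zpow] at h3
    omega

/-- Two ultrametric balls are nested or disjoint. -/
lemma integral_inter_ball (hϖ : IsUniformizer ϖ) {y : F} {e ρ : ℤ} (hy : ‖y‖ = ‖ϖ‖ ^ e) :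
    ((0 ≤ e ∨ ρ ≤ e) → ∃ x₀ : F, {x : F | ‖x‖ ≤ 1 ∧ ‖x - y‖ ≤ ‖ϖ‖ ^ ρ} =
      {x | ‖x - x₀‖ ≤ ‖ϖ‖ ^ (max ρ 0)}) ∧
    (¬ (0 ≤ e ∨ ρ ≤ e) → {x : F | ‖x‖ ≤ 1 ∧ ‖x - y‖ ≤ ‖ϖ‖ ^ ρ} = ∅) := by
  have hle1 : ∀ k : ℤ, ‖ϖ‖ ^ k ≤ 1 ↔ 0 ≤ k := fun k => by
    rw [← zpow_zero ‖ϖ‖, hϖ.zpow_le_zpow]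
  have hmax : ∀ t : ℝ, t ≤ ‖ϖ‖ ^ (max ρ 0) ↔ t ≤ 1 ∧ t ≤ ‖ϖ‖ ^ ρ := by
    intro t
    rcases le_total ρ 0 with h | h
    · rw [max_eq_right h, zpow_zero]
      refine ⟨fun ht => ⟨ht, ht.trans ?_⟩, fun ht => ht.1⟩
      rw [← zpow_zero ‖ϖ‖, hϖ.zpow_le_zpow]; exact h
    · rw [max_eq_left h]
      exact ⟨fun ht => ⟨ht.trans ((hle1 _).2 h), ht⟩, fun ht => ht.2⟩
  constructor
  · intro h
    rcases le_or_gt 0 e with he | he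
    · refine ⟨y, ?_⟩
      ext x
      have hy1 : ‖y‖ ≤ 1 := by rw [hy, hle1]; exact he
      simp only [Set.mem_ofPred_eq, hmax]
      refine and_congr_left fun _ => ⟨fun hx => ?_, fun hx => ?_⟩
      · rw [sub_eq_add_neg]
        exact (IsUltrametricDist.norm_add_le_max _ _).trans (max_le hx (by rwa [norm_neg]))
      · rw [← sub_add_cancel x y]
        exact (IsUltrametricDist.norm_add_le_max _ _).trans (max_le hx hy1)
    · have hρ : ρ ≤ e := by omega
      refine ⟨0, ?_⟩
      ext x
      rw [max_eq_right (by omega)]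
      simp only [Set.mem_ofPred_eq, sub_zero, zpow_zero, and_iff_left_iff_imp]
      intro hx
      rw [sub_eq_add_neg]
      refine (IsUltrametricDist.norm_add_le_max _ _).trans (max_le (hx.trans ?_) ?_)
      · rw [← zpow_zero ‖ϖ‖, hϖ.zpow_le_zpow]; omega
      · rw [norm_neg, hy, hϖ.zpow_le_zpow]; exact hρ
  · intro h
    ext x
    simp only [Set.mem_ofPred_eq, Set.mem_empty_iff_false, iff_false, not_and]
    intro hx hxy
    have : ‖x‖ < ‖y‖ := hx.trans_lt (by
      rw [hy, ← zpow_zero ‖ϖ‖, hϖ.zpow_lt_zpow]; omega)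
    rw [norm_sub_eq_of_lt this, hy, hϖ.zpow_le_zpow] at hxy
    omega

/-- The condition reads `‖x - x₁‖ * ‖x - x₂‖ ≤ ρ * ‖x₁ - x₂‖` with `ρ = ‖ϖ‖ ^ (n - r - D)` smaller
than the distance of the roots. So `x` is within `ρ` of one root and at distance `‖x₁ - x₂‖` from
the other. The bound `‖x‖ ≤ ‖ϖ‖ ^ (m - C - r)` is then automatic. -/
lemma admissible_eq_union [CompleteSpace F] (hϖ : IsUniformizer ϖ) (hκ : ‖κ‖ = ‖ϖ‖ ^ (C - B))
    {D : ℕ} (hD : 2 * D < B + C) (hτ : ‖τ‖ = ‖ϖ‖ ^ (D - B)) {n i : ℕ} (hi : 2 * (r + D) < i) :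
    ∃ x₁ x₂ : F, ‖x₁‖ = ‖ϖ‖ ^ (r + C + n - i + B - D : ℤ) ∧ ‖x₂‖ = ‖ϖ‖ ^ (r + n + D - i : ℤ) ∧
      ‖x₁ - x₂‖ = ‖ϖ‖ ^ (r + n + D - i : ℤ) ∧
      admissible ϖ κ τ r B C (r + C + n - i) n =
        {x | ‖x‖ ≤ 1 ∧ ‖x - x₁‖ ≤ ‖ϖ‖ ^ (n - r - D : ℤ)} ∪
        {x | ‖x‖ ≤ 1 ∧ ‖x - x₂‖ ≤ ‖ϖ‖ ^ (n - r - D : ℤ)} := by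
  obtain ⟨m, hm⟩ : ∃ m : ℤ, m = r + C + n - i := ⟨_, rfl⟩
  have hp := hϖ.norm_pos
  have hκ0 : κ ≠ 0 := norm_pos_iff.1 (by rw [hκ]; positivity)
  obtain ⟨z₁, z₂, h1, h2, h12, hfac⟩ := exists_factorization hκ0 (τ := τ) (by
    rw [hκ, hτ, ← zpow_natCast, ← zpow_mul, hϖ.zpow_lt_zpow]; push_cast; omega)
  have n1 : ‖ϖ ^ m * z₁‖ = ‖ϖ‖ ^ (r + C + n - i + B - D : ℤ) := by
    rw [norm_mul, norm_zpow, h1, hτ, ← zpow_neg, ← zpow_add₀ hp.ne']; congr 1; omega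
  have n2 : ‖ϖ ^ m * z₂‖ = ‖ϖ‖ ^ (r + n + D - i : ℤ) := by
    rw [norm_mul, norm_zpow, h2, hτ, hκ, ← zpow_sub₀ hp.ne', ← zpow_add₀ hp.ne']; congr 1; omega
  have n12 : ‖ϖ ^ m * z₁ - ϖ ^ m * z₂‖ = ‖ϖ‖ ^ (r + n + D - i : ℤ) := by
    rw [← mul_sub, norm_mul, norm_zpow, h12, hτ, hκ, ← zpow_sub₀ hp.ne', ← zpow_add₀ hp.ne']
    congr 1; omega
  refine ⟨ϖ ^ m * z₁, ϖ ^ m * z₂, n1, n2, n12, ?_⟩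
  rw [← hm]
  replace hfac := hfac (ϖ ^ m)
  generalize ϖ ^ m * z₁ = x₁ at *
  generalize ϖ ^ m * z₂ = x₂ at *
  ext x
  simp only [admissible, Set.mem_ofPred_eq, Set.mem_union, ← and_or_left]
  refine and_congr_right fun hx => ?_
  have hexp : ‖ϖ‖ ^ (m + n - r - B : ℤ) =
      ‖κ‖ * (‖ϖ‖ ^ (n - r - D : ℤ) * ‖ϖ‖ ^ (r + n + D - i : ℤ)) := by
    rw [hκ, ← zpow_add₀ hp.ne', ← zpow_add₀ hp.ne']; congr 1; omega
  have hκ' : 0 < ‖κ‖ := norm_pos_iff.2 hκ0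
  rw [hexp, hfac, norm_mul, norm_neg, norm_mul, mul_le_mul_iff_right₀ hκ']
  have hlt : ‖ϖ‖ ^ (n - r - D : ℤ) < ‖ϖ‖ ^ (r + n + D - i : ℤ) := by
    rw [hϖ.zpow_lt_zpow]; omega
  have hρ : 0 < ‖ϖ‖ ^ (n - r - D : ℤ) := zpow_pos hp _
  constructor
  · rintro ⟨-, h⟩
    by_contra! hcon
    have hmax : ‖ϖ‖ ^ (r + n + D - i : ℤ) ≤ max ‖x - x₁‖ ‖x - x₂‖ := by
      rw [← n12, show x₁ - x₂ = (x - x₂) + -(x - x₁) by ring, max_comm, ← norm_neg (x - x₁)]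
      exact IsUltrametricDist.norm_add_le_max _ _
    rcases le_max_iff.1 hmax with h3 | h3
    · nlinarith [mul_lt_mul_of_pos_right hcon.2 (hρ.trans hlt), norm_nonneg (x - x₂)]
    · nlinarith [mul_lt_mul_of_pos_right hcon.1 (hρ.trans hlt), norm_nonneg (x - x₁)]
  · have small : ∀ y : F, ‖y‖ ≤ ‖ϖ‖ ^ (m - C - r) → ‖x - y‖ ≤ ‖ϖ‖ ^ (n - r - D : ℤ) →
        ‖x‖ ≤ ‖ϖ‖ ^ (m - C - r) := by
      intro y hy hxy
      rw [← sub_add_cancel x y]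
      refine (IsUltrametricDist.norm_add_le_max _ _).trans (max_le (hxy.trans ?_) hy)
      rw [hϖ.zpow_le_zpow]; omega
    rintro (h | h)
    · refine ⟨small x₁ (by rw [n1, hϖ.zpow_le_zpow]; omega) h, ?_⟩
      have : ‖x - x₂‖ = ‖ϖ‖ ^ (r + n + D - i : ℤ) := by
        rw [← n12, ← sub_add_sub_cancel x x₁ x₂]
        exact norm_add_eq_of_lt (by rw [n12]; exact h.trans_lt hlt)
      rw [this]
      gcongr
    · refine ⟨small x₂ (by rw [n2, hϖ.zpow_le_zpow]; omega) h, ?_⟩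
      have : ‖x - x₁‖ = ‖ϖ‖ ^ (r + n + D - i : ℤ) := by
        rw [← n12, norm_sub_rev x₁, ← sub_add_sub_cancel x x₂ x₁]
        rw [norm_sub_rev x₁] at n12
        exact norm_add_eq_of_lt (by rw [n12]; exact h.trans_lt hlt)
      rw [this, mul_comm]
      gcongr

/-- Admissibility depends only on `x` modulo `ϖ ^ n`: the quadratic changes by `(x - y) * (κ (x + y)
- τ α)`, whose second factor is controlled by the second admissibility bound. -/
lemma add_mem_admissible_iff (hϖ : IsUniformizer ϖ) (hκ : ‖κ‖ = ‖ϖ‖ ^ (C - B))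
    (hτ : ‖τ‖ ≤ ‖ϖ‖ ^ (-B)) {m n : ℤ} (hn : 0 ≤ n) (hm : m ≤ n + C + r) {x y : F}
    (hxy : ‖x - y‖ ≤ ‖ϖ‖ ^ n) (hx : x ∈ admissible ϖ κ τ r B C m n) :
    y ∈ admissible ϖ κ τ r B C m n := by
  have hp := hϖ.norm_pos
  obtain ⟨h1, h2, h3⟩ := hx
  have key : ∀ k : ℤ, k ≤ n → ‖x‖ ≤ ‖ϖ‖ ^ k → ‖y‖ ≤ ‖ϖ‖ ^ k := by
    intro k hk hx
    rw [show y = x + -(x - y) by ring]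
    refine (IsUltrametricDist.norm_add_le_max _ _).trans (max_le hx ?_)
    rw [norm_neg]
    exact hxy.trans (hϖ.zpow_le_zpow.2 hk)
  have h1' : ‖y‖ ≤ 1 := by
    rw [← zpow_zero ‖ϖ‖] at h1 ⊢
    exact key 0 hn h1
  have h2' := key (m - C - r) (by omega) h2
  refine ⟨h1', h2', ?_⟩
  rw [show (ϖ ^ m) ^ 2 + τ * ϖ ^ m * y - κ * y ^ 2 =
    ((ϖ ^ m) ^ 2 + τ * ϖ ^ m * x - κ * x ^ 2) + (x - y) * (κ * (x + y) + -(τ * ϖ ^ m)) by ring]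
  refine (IsUltrametricDist.norm_add_le_max _ _).trans (max_le h3 ?_)
  have hsum : ‖κ * (x + y) + -(τ * ϖ ^ m)‖ ≤ ‖ϖ‖ ^ (m - r - B) := by
    refine (IsUltrametricDist.norm_add_le_max _ _).trans (max_le ?_ ?_)
    · rw [norm_mul, hκ]
      calc ‖ϖ‖ ^ (C - B) * ‖x + y‖ ≤ ‖ϖ‖ ^ (C - B) * ‖ϖ‖ ^ (m - C - r) := by
            gcongr
            exact (IsUltrametricDist.norm_add_le_max _ _).trans (max_le h2 h2')
        _ = ‖ϖ‖ ^ (m - r - B) := by rw [← zpow_add₀ hp.ne']; congr 1; omega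
    · rw [norm_neg, norm_mul, norm_zpow]
      calc ‖τ‖ * ‖ϖ‖ ^ m ≤ ‖ϖ‖ ^ (-B) * ‖ϖ‖ ^ m := by gcongr
        _ = ‖ϖ‖ ^ (m - B) := by rw [← zpow_add₀ hp.ne']; congr 1; omega
        _ ≤ _ := hϖ.zpow_le_zpow.2 (by omega)
  rw [norm_mul]
  calc ‖x - y‖ * ‖κ * (x + y) + -(τ * ϖ ^ m)‖ ≤ ‖ϖ‖ ^ n * ‖ϖ‖ ^ (m - r - B) := by gcongr
    _ = _ := by rw [← zpow_add₀ hp.ne']; congr 1; omega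

end Admissible

/-! ### Counting admissible classes -/

section CellSets

variable {F : Type*} [NormedField F] [IsUltrametricDist F]

lemma cell_empty (α β : Fˣ) : cell α β (∅ : Set F) = ∅ := by
  ext; simp [cell]

lemma cell_union (α β : Fˣ) (X Y : Set F) : cell α β (X ∪ Y) = cell α β X ∪ cell α β Y := by
  ext; simp [cell, or_and_right, exists_or]

end CellSets

section CellVolume

variable {F : Type*} [NormedField F] [IsUltrametricDist F] [ProperSpace F]
  [MeasurableSpace (Matrix.GeneralLinearGroup (Fin 2) F)]
  [BorelSpace (Matrix.GeneralLinearGroup (Fin 2) F)]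
  (μ : Measure (Matrix.GeneralLinearGroup (Fin 2) F)) [μ.IsHaarMeasure]
  {ϖ κ τ : F} {r : ℕ} {B C : ℤ}

/-- The number of residue classes of `x` modulo `ϖ ^ n` which are admissible for
`m = r + C + n - i`. -/
def classCount (q r : ℕ) (A : ℤ) (D n i : ℕ) : ℕ :=
  q ^ min n (min (i / 2) (r + D)) *
    ((if (i : ℤ) ≤ r + A + max (r : ℤ) (n - D) then 1 else 0) +
      if 2 * (r + D) < i ∧ i ≤ r + n + D then 1 else 0)

lemma measure_cell_of_large (h2 : (2 : F) ≠ 0) (hϖ : IsUniformizer ϖ)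
    (hμ : μ (integralGL 2 F) = 1) (hκ : ‖κ‖ = ‖ϖ‖ ^ (C - B)) {D : ℤ}
    (hD : 2 * D = B + C + 1) (hτ : ‖τ‖ ≤ ‖ϖ‖ ^ (D - B)) {n i : ℕ}
    (hi : (i : ℤ) ≤ 2 * r + B + C) :
    μ (cell (hϖ.unit ^ (r + C + n - i)) (hϖ.unit ^ (n : ℤ))
      (admissible ϖ κ τ r B C (r + C + n - i) n)) = ((residueCard F ^ min n (i / 2) : ℕ) : ENNReal) := by
  rw [admissible_eq_ball hϖ hκ hD.le hτ (by omega) hi, measure_cell_ball μ h2 hϖ hμ]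
  push_cast; rfl

lemma measure_cell_of_small (h2 : (2 : F) ≠ 0) (hϖ : IsUniformizer ϖ)
    (hμ : μ (integralGL 2 F) = 1) (hκ : ‖κ‖ = ‖ϖ‖ ^ (C - B)) {D : ℕ}
    (hD : 2 * D < B + C) (hτ : ‖τ‖ = ‖ϖ‖ ^ (D - B)) (n i : ℕ) :
    μ (cell (hϖ.unit ^ (r + C + n - i)) (hϖ.unit ^ (n : ℤ))
      (admissible ϖ κ τ r B C (r + C + n - i) n)) =
      (classCount (residueCard F) r (B + C) D n i : ENNReal) := by
  rcases le_or_gt i (2 * (r + D)) with hi | hi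
  · rw [admissible_eq_ball hϖ hκ (by omega) hτ.le (by omega) (by omega),
      measure_cell_ball μ h2 hϖ hμ, classCount, if_pos (by omega), if_neg (by omega)]
    rw [show min (i / 2) (r + D) = i / 2 by omega]
    push_cast; ring
  · obtain ⟨x₁, x₂, h1, h2', h12, heq⟩ := admissible_eq_union hϖ hκ hD hτ (n := n) hi
    -- The roots are further apart than both the radius of the balls and `‖ϖ‖ ^ n`, so no coset is
    -- near both.
    have hdisj : Disjoint
        (cell (hϖ.unit ^ (r + C + n - i)) (hϖ.unit ^ (n : ℤ))
          {x : F | ‖x‖ ≤ 1 ∧ ‖x - x₁‖ ≤ ‖ϖ‖ ^ (n - r - D : ℤ)})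
        (cell (hϖ.unit ^ (r + C + n - i)) (hϖ.unit ^ (n : ℤ))
          {x : F | ‖x‖ ≤ 1 ∧ ‖x - x₂‖ ≤ ‖ϖ‖ ^ (n - r - D : ℤ)}) := by
      refine Set.disjoint_left.2 ?_
      rintro g ⟨x, ⟨-, hx⟩, hk⟩ ⟨y, ⟨-, hy⟩, hk'⟩
      have h3 := mul_mem (inv_mem hk) hk'
      rw [mul_inv_rev, inv_inv, mul_assoc, inv_mul_cancel_left, upper_mul_inv_mem_iff] at h3
      have hle : ‖x₁ - x₂‖ ≤ ‖ϖ‖ ^ (n - r - D : ℤ) := by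
        rw [show x₁ - x₂ = (-(x - x₁) + (y - x₂)) + (x - y) by ring]
        refine (IsUltrametricDist.norm_add_le_max _ _).trans (max_le
          ((IsUltrametricDist.norm_add_le_max _ _).trans (max_le (by rwa [norm_neg]) hy))
          (h3.2.2.trans ?_))
        rw [hϖ.zpow_le_zpow]; omega
      rw [h12, hϖ.zpow_le_zpow] at hle
      omega
    have hvol : ∀ (y : F) (e : ℤ), ‖y‖ = ‖ϖ‖ ^ e →
        μ (cell (hϖ.unit ^ (r + C + n - i)) (hϖ.unit ^ (n : ℤ))
          {x : F | ‖x‖ ≤ 1 ∧ ‖x - y‖ ≤ ‖ϖ‖ ^ (n - r - D : ℤ)}) =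
        ((residueCard F ^ min n (r + D) * if 0 ≤ e ∨ n - r - D ≤ e then 1 else 0 : ℕ) :
          ENNReal) := by
      intro y e hy
      split_ifs with h
      · obtain ⟨x₀, hx₀⟩ := (integral_inter_ball hϖ hy).1 h
        rw [hx₀, show max (n - r - D : ℤ) 0 = n - (min n (r + D) : ℕ) by omega,
          measure_cell_ball μ h2 hϖ hμ]
        push_cast; ring
      · rw [(integral_inter_ball hϖ hy).2 h, cell_empty]
        simp
    rw [heq, cell_union, measure_union hdisj (isOpen_cell _ _ _).measurableSet,
      hvol _ _ h1, hvol _ _ h2', classCount, ← Nat.cast_add, ← mul_add]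
    rw [show min n (min (i / 2) (r + D)) = min n (r + D) by omega]
    refine congrArg Nat.cast (congrArg₂ _ rfl (congrArg₂ _ (if_congr ?_ rfl rfl)
      (if_congr ?_ rfl rfl))) <;> omega

end CellVolume

/-! ### Summation of the counts to the Gross-Keating polynomial -/

section GrossKeating

open Finset

lemma grossKeating_even (q k : ℕ) (n₂ : ℤ) :
    grossKeating q (2 * k) n₂ = (n₂ - 2 * k + 1 : ℚ) / 2 * (q : ℚ) ^ k +
      ∑ j ∈ range k, (2 * k + n₂ - 4 * j : ℚ) * (q : ℚ) ^ j := by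
  have h : ¬ Odd (2 * k : ℤ) := by simp
  rw [grossKeating, if_neg h, show (2 * k : ℤ) / 2 = k by omega, zpow_natCast]
  push_cast
  congr 1
  refine (sum_nbij (fun j : ℕ => (j : ℤ)) ?_ ?_ ?_ ?_).symm
  · intro j hj; simp only [mem_range, mem_Icc] at *; omega
  · exact fun a _ b _ hab => by simpa using hab
  · intro j hj
    simp only [coe_Icc, Set.mem_Icc] at hj
    exact ⟨j.toNat, by simp; omega, by simp; omega⟩
  · intro j _; simp

lemma grossKeating_odd (q k : ℕ) (n₂ : ℤ) :
    grossKeating q (2 * k + 1) n₂ =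
      ∑ j ∈ range (k + 1), (2 * k + 1 + n₂ - 4 * j : ℚ) * (q : ℚ) ^ j := by
  have h : Odd (2 * k + 1 : ℤ) := by simp
  rw [grossKeating, if_pos h, show (2 * k + 1 - 1 : ℤ) / 2 = k by omega]
  push_cast
  refine (sum_nbij (fun j : ℕ => (j : ℤ)) ?_ ?_ ?_ ?_).symm
  · intro j hj; simp only [mem_range, mem_Icc] at *; omega
  · exact fun a _ b _ hab => by simpa using hab
  · intro j hj
    simp only [coe_Icc, Set.mem_Icc] at hj
    exact ⟨j.toNat, by simp; omega, by simp; omega⟩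
  · intro j _; simp

/-- The terms `i = 2j` and `i = 2j + 1` share the weight `w j`, and their coefficients differ by
exactly 1; hence `K` drops out. -/
lemma sum_range_two_mul_alternating (K : ℚ) (w : ℕ → ℚ) (t : ℕ) :
    ∑ i ∈ range (2 * t), (-1) ^ i * (K - i) * w (i / 2) = ∑ j ∈ range t, w j := by
  induction t with
  | zero => simp
  | succ t ih =>
    rw [mul_add, mul_one, sum_range_succ, sum_range_succ, ih, sum_range_succ]
    rw [show (2 * t + 1) / 2 = t by omega, show (2 * t) / 2 = t by omega]
    rw [pow_succ, pow_mul]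
    push_cast
    ring

/-- `∑ i < N, (-1) ^ i * (K - i)` in closed form. -/
def altSum (K : ℚ) (N : ℕ) : ℚ := (2 * K + 1 - (-1) ^ N * (2 * K + 1 - 2 * N)) / 4

lemma altSum_succ (K : ℚ) (N : ℕ) : altSum K (N + 1) = altSum K N + (-1) ^ N * (K - N) := by
  simp only [altSum, pow_succ]; push_cast; ring

lemma sum_alternating_truncated (K x : ℚ) (R u : ℕ) :
    ∑ i ∈ range (2 * R + u), (-1) ^ i * (K - i) * x ^ min (i / 2) R =
      ∑ j ∈ range R, x ^ j + x ^ R * (altSum K (2 * R + u) - altSum K (2 * R)) := by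
  induction u with
  | zero =>
    rw [add_zero, sub_self, mul_zero, add_zero,
      sum_range_two_mul_alternating K (fun j => x ^ min j R)]
    exact sum_congr rfl fun j hj => by rw [min_eq_left (mem_range.1 hj).le]
  | succ u ih =>
    rw [← add_assoc, sum_range_succ, ih, altSum_succ,
      show min ((2 * R + u) / 2) R = R by omega]
    ring

/-- This is the contribution of the ball around the second root, which contains integral points only
for `i` in a window of length `t`. -/
lemma sum_alternating_window (K x : ℚ) (R t u : ℕ) :
    ∑ i ∈ range (2 * R + 1 + u), (-1) ^ i * (K - i) *
      (x ^ min (i / 2) R * if 2 * R < i ∧ i ≤ 2 * R + t then 1 else 0) =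
      x ^ R * (altSum K (2 * R + 1 + min u t) - altSum K (2 * R + 1)) := by
  induction u with
  | zero =>
    rw [add_zero, Nat.zero_min, add_zero, sub_self, mul_zero]
    refine sum_eq_zero fun i hi => ?_
    rw [if_neg (by have := mem_range.1 hi; omega)]
    ring
  | succ u ih =>
    rw [← add_assoc, sum_range_succ, ih, show min ((2 * R + 1 + u) / 2) R = R by omega]
    rcases lt_or_ge u t with h | h
    · rw [if_pos (by omega), show min (u + 1) t = min u t + 1 by omega, show min u t = u by omega,
        ← add_assoc (2 * R + 1), altSum_succ K (2 * R + 1 + u)]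
      ring
    · rw [if_neg (by omega), show min (u + 1) t = min u t by omega]
      ring

/-- The range where `n₁ = 2e`; raising `e` by one adds `S e + S (e + 1)`. -/
lemma doubled_sum_of_le (x : ℚ) (M T : ℕ) (S : ℕ → ℚ)
    (hS : ∀ n ≤ T, S n = ∑ j ∈ range n, x ^ j + (M + 1 - n) * x ^ n) {e : ℕ} (he : e ≤ T) :
    ∑ n ∈ range (e + 1), S n + ∑ n ∈ range e, S n =
      (M + 1 - e) * x ^ e + ∑ j ∈ range e, (2 * e + 2 * M + 1 - 4 * j) * x ^ j := by
  induction e with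
  | zero => simp [hS 0 he]
  | succ e ih =>
    have ih := ih (by omega)
    rw [sum_range_succ _ (e + 1), sum_range_succ _ e]
    rw [sum_range_succ _ e] at ih
    have h3 : ∑ j ∈ range (e + 1), (2 * (e + 1 : ℕ) + 2 * M + 1 - 4 * j : ℚ) * x ^ j =
        ∑ j ∈ range e, (2 * e + 2 * M + 1 - 4 * j : ℚ) * x ^ j + 2 * ∑ j ∈ range e, x ^ j +
        (2 * M + 3 - 2 * e) * x ^ e := by
      rw [sum_range_succ, mul_sum, ← sum_add_distrib]
      congr 1
      · exact sum_congr rfl fun j _ => by push_cast; ring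
      · push_cast; ring
    rw [h3, hS e (by omega), hS (e + 1) he, sum_range_succ]
    rw [hS e (by omega)] at ih
    push_cast
    linear_combination ih

/-- The range where `n₁` no longer depends on `e`. Only sums of consecutive `S n` need be constant,
since `S` itself may oscillate. -/
lemma doubled_sum_of_ge {T : ℕ} {S : ℕ → ℚ} {γ : ℚ}
    (hS : ∀ n, T ≤ n → S n + S (n + 1) = γ) (t : ℕ) :
    ∑ n ∈ range (T + t + 1), S n + ∑ n ∈ range (T + t), S n =
      ∑ n ∈ range (T + 1), S n + ∑ n ∈ range T, S n + t * γ := by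
  induction t with
  | zero => simp
  | succ t ih =>
    rw [← add_assoc, sum_range_succ _ (T + t + 1), sum_range_succ _ (T + t)]
    rw [sum_range_succ _ (T + t)] at ih
    have := hS (T + t) (by omega)
    push_cast
    linear_combination ih + this

lemma sum_pow_min_of_le (x : ℚ) {n N : ℕ} (h : n ≤ N) :
    ∑ j ∈ range N, x ^ min n j = ∑ j ∈ range n, x ^ j + (N - n) * x ^ n := by
  obtain ⟨k, rfl⟩ := Nat.exists_eq_add_of_le h
  rw [sum_range_add]
  congr 1
  · exact sum_congr rfl fun j hj => by rw [min_eq_right (mem_range.1 hj).le]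
  · rw [sum_congr rfl (fun j _ => by rw [min_eq_left (Nat.le_add_right n j)])]
    simp

/-- The Gross-Keating formula for the sums that occur when `v(b) + v(c) < 2 v(d - a)`. -/
lemma doubled_sum_large (q M e : ℕ) (K : ℕ → ℚ) :
    ∑ n ∈ range (e + 1), ∑ i ∈ range (2 * (M + 1)), (-1) ^ i * (K n - i) * (q : ℚ) ^ min n (i / 2) +
      ∑ n ∈ range e, ∑ i ∈ range (2 * (M + 1)), (-1) ^ i * (K n - i) * (q : ℚ) ^ min n (i / 2) =
    grossKeating q (min (2 * (e : ℤ)) (2 * M + 1))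
      (2 * e + (2 * M + 1) - min (2 * (e : ℤ)) (2 * M + 1)) := by
  simp only [fun n => sum_range_two_mul_alternating (K n) (fun j => (q : ℚ) ^ min n j) (M + 1)]
  have hS : ∀ n ≤ M + 1, ∑ j ∈ range (M + 1), (q : ℚ) ^ min n j =
      ∑ j ∈ range n, (q : ℚ) ^ j + (M + 1 - n) * (q : ℚ) ^ n := fun n hn => by
    rw [sum_pow_min_of_le _ hn]; push_cast; ring
  rcases le_or_gt e M with he | he
  · rw [doubled_sum_of_le _ M (M + 1) _ hS (by omega),
      show min (2 * (e : ℤ)) (2 * M + 1) = 2 * e by omega, grossKeating_even]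
    push_cast
    congr 1
    · ring
    · exact sum_congr rfl fun j _ => by ring
  · obtain ⟨t, rfl⟩ := Nat.exists_eq_add_of_le (show M + 1 ≤ e by omega)
    rw [doubled_sum_of_ge (γ := 2 * ∑ j ∈ range (M + 1), (q : ℚ) ^ j),
      doubled_sum_of_le _ M (M + 1) _ hS le_rfl,
      show min (2 * ((M + 1 + t : ℕ) : ℤ)) (2 * M + 1) = 2 * M + 1 by omega,
      grossKeating_odd, mul_sum, mul_sum]
    · push_cast
      rw [sub_self, zero_mul, zero_add, ← sum_add_distrib]
      exact sum_congr rfl fun j _ => by ring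
    · intro n hn
      rw [two_mul]
      congr 1 <;>
      · refine sum_congr rfl fun j hj => ?_
        rw [min_eq_right (by have := mem_range.1 hj; omega)]

/-- The Gross-Keating formula for the sums that occur when `2 v(d - a) < v(b) + v(c)`. -/
lemma doubled_sum_small (q r a D e : ℕ) (hD : D ≤ a) (K : ℕ → ℚ) (L : ℕ → ℕ)
    (hL : ∀ n, (L n : ℤ) = r + (2 * a + 1) + max (r : ℤ) (n - D) + 1) :
    ∑ n ∈ range (e + 1), ∑ i ∈ range (L n), (-1) ^ i * (K n - i) *
        (classCount q r (2 * a + 1) D n i : ℚ) +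
      ∑ n ∈ range e, ∑ i ∈ range (L n), (-1) ^ i * (K n - i) *
        (classCount q r (2 * a + 1) D n i : ℚ) =
    grossKeating q (min (2 * (e : ℤ)) (2 * (r + D)))
      (2 * e + (2 * (r + a) + 1) - min (2 * (e : ℤ)) (2 * (r + D))) := by
  have hsmall : ∀ n ≤ r + D, ∑ i ∈ range (L n), (-1) ^ i * (K n - i) *
        (classCount q r (2 * a + 1) D n i : ℚ) =
      ∑ j ∈ range n, (q : ℚ) ^ j + ((r + a : ℕ) + 1 - n) * (q : ℚ) ^ n := by
    intro n hn
    have := hL n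
    -- For `n ≤ r + D` the window of the second root is empty and the cutoff is even, so the terms
    -- pair off as in the other regime.
    rw [show L n = 2 * (r + a + 1) by omega]
    have h1 : ∀ i ∈ range (2 * (r + a + 1)), (-1) ^ i * (K n - i) *
        (classCount q r (2 * a + 1) D n i : ℚ) =
        (-1) ^ i * (K n - i) * (fun j => (q : ℚ) ^ min n j) (i / 2) := by
      intro i hi
      have := mem_range.1 hi
      rw [classCount, if_pos (by omega), if_neg (by omega),
        show min n (min (i / 2) (r + D)) = min n (i / 2) by omega]
      push_cast; ring
    rw [sum_congr rfl h1,
      sum_range_two_mul_alternating (K n) (fun j => (q : ℚ) ^ min n j), sum_pow_min_of_le _ (by omega)]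
    push_cast; ring
  have hlarge : ∀ t : ℕ, ∑ i ∈ range (L (r + D + t)), (-1) ^ i * (K (r + D + t) - i) *
        (classCount q r (2 * a + 1) D (r + D + t) i : ℚ) =
      ∑ j ∈ range (r + D), (q : ℚ) ^ j +
        (q : ℚ) ^ (r + D) * (1 / 2 + (-1) ^ t * (2 * a + 1 - 2 * D) / 2) := by
    intro t
    generalize K (r + D + t) = k
    have := hL (r + D + t)
    have hL' : L (r + D + t) = 2 * (r + a + 1) + t := by push_cast at this; omega
    rw [hL']
    have h1 : ∀ i ∈ range (2 * (r + a + 1) + t), (-1) ^ i * (k - i) *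
        (classCount q r (2 * a + 1) D (r + D + t) i : ℚ) =
        (-1) ^ i * (k - i) * (q : ℚ) ^ min (i / 2) (r + D) + (-1) ^ i * (k - i) *
        ((q : ℚ) ^ min (i / 2) (r + D) *
          if 2 * (r + D) < i ∧ i ≤ 2 * (r + D) + t then 1 else 0) := by
      intro i hi
      have := mem_range.1 hi
      rw [classCount, if_pos (by push_cast; omega),
        show min (r + D + t) (min (i / 2) (r + D)) = min (i / 2) (r + D) by omega]
      simp only [show (2 * (r + D) < i ∧ i ≤ r + (r + D + t) + D) ↔
          (2 * (r + D) < i ∧ i ≤ 2 * (r + D) + t) by omega]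
      push_cast; ring
    rw [sum_congr rfl h1, sum_add_distrib]
    obtain ⟨u, hu⟩ := Nat.exists_eq_add_of_le (show 2 * (r + D) + 1 + t ≤ 2 * (r + a + 1) + t by omega)
    have e1 := sum_alternating_truncated k q (r + D) (1 + t + u)
    have e2 := sum_alternating_window k q (r + D) t (t + u)
    rw [show 2 * (r + D) + (1 + t + u) = 2 * (r + a + 1) + t by omega] at e1
    rw [show 2 * (r + D) + 1 + (t + u) = 2 * (r + a + 1) + t by omega,
      show min (t + u) t = t by omega] at e2
    rw [e1, e2]
    -- The window adds the `t` terms that restore the parity balance, so `k` cancels; what remains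
    -- oscillates with `(-1) ^ t`.
    simp only [altSum, pow_add, pow_mul]
    push_cast
    ring
  rcases le_or_gt e (r + D) with he | he
  · rw [doubled_sum_of_le _ (r + a) (r + D) _ hsmall he,
      show min (2 * (e : ℤ)) (2 * (r + D)) = 2 * e by omega, grossKeating_even]
    push_cast
    congr 1
    · ring
    · exact sum_congr rfl fun j _ => by ring
  · obtain ⟨t, rfl⟩ := Nat.exists_eq_add_of_le he.le
    rw [doubled_sum_of_ge (γ := 2 * ∑ j ∈ range (r + D), (q : ℚ) ^ j + (q : ℚ) ^ (r + D)),
      doubled_sum_of_le _ (r + a) (r + D) _ hsmall le_rfl,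
      show min (2 * ((r + D + t : ℕ) : ℤ)) (2 * (r + D)) = 2 * (r + D) by omega]
    · have e3 := grossKeating_even q (r + D) (2 * ((r + D + t : ℕ) : ℤ) + (2 * (r + a) + 1) - 2 * (r + D))
      push_cast at e3 ⊢
      rw [e3]
      have e4 : ∑ j ∈ range (r + D), (2 * (r + D : ℚ) + (2 * (r + D + t) + (2 * (r + a) + 1) -
            2 * (r + D)) - 4 * j) * (q : ℚ) ^ j =
          ∑ j ∈ range (r + D), (2 * (r + D : ℚ) + 2 * (r + a) + 1 - 4 * j) * (q : ℚ) ^ j +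
          (t : ℚ) * (2 * ∑ j ∈ range (r + D), (q : ℚ) ^ j) := by
        rw [mul_sum, mul_sum, ← sum_add_distrib]
        exact sum_congr rfl fun j _ => by ring
      rw [e4]
      ring
    · intro n hn
      obtain ⟨t', rfl⟩ := Nat.exists_eq_add_of_le hn
      rw [hlarge, add_assoc (r + D), hlarge, pow_succ]
      ring

end GrossKeating

/-! ### The quadratic extension and the entries of `γ` -/

section Extension

variable {F : Type*} [NormedField F] {E : Type*} [NormedField E]

lemma ord_eq_of_norm_eq {ϖ : F} (hϖ : IsUniformizer ϖ) {x : E} {k : ℤ} (h : ‖x‖ = ‖ϖ‖ ^ k) :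
    ord ϖ x = k := by
  rw [ord, h, ← Real.rpow_intCast, Real.logb_rpow hϖ.norm_pos hϖ.2.1.ne, Int.floor_intCast]

lemma ord_congr_norm {E' : Type*} [NormedField E'] (ϖ : F) {x : E} {y : E'} (h : ‖x‖ = ‖y‖) :
    ord ϖ x = ord ϖ y := by
  rw [ord, ord, h]

lemma norm_eq_zpow_ord_self {ϖ : F} (hϖ : IsUniformizer ϖ) {x : F} (hx : x ≠ 0) :
    ‖x‖ = ‖ϖ‖ ^ ord ϖ x := by
  obtain ⟨k, hk⟩ := hϖ.exists_norm_eq_zpow hx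
  rw [ord_eq_of_norm_eq hϖ hk, hk]

variable [NormedAlgebra F E]

lemma norm_eq_zpow_ord (hE : IsUnramifiedQuadratic F E) {ϖ : F} (hϖ : IsUniformizer ϖ) {x : E}
    (hx : x ≠ 0) : ‖x‖ = ‖ϖ‖ ^ ord ϖ x := by
  obtain ⟨y, hy⟩ := hE.2 x
  have hy0 : y ≠ 0 := norm_pos_iff.1 (hy ▸ norm_pos_iff.2 hx)
  rw [← hy, norm_eq_zpow_ord_self hϖ hy0, ord_congr_norm ϖ hy]

lemma isUltrametricDist_of_normedAlgebra (F E : Type*) [NormedField F] [IsUltrametricDist F]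
    [NormedField E] [NormedAlgebra F E] : IsUltrametricDist E := by
  refine IsUltrametricDist.isUltrametricDist_of_forall_norm_natCast_le_one fun n => ?_
  rw [← map_natCast (algebraMap F E) n, norm_algebraMap']
  exact IsUltrametricDist.norm_natCast_le_one F n

/-- In finite dimension `σ` is bounded; since the norm is multiplicative, applying the bound to `x ^
n` forces the constant down to 1. -/
lemma norm_algEquiv_le [CompleteSpace F] [FiniteDimensional F E] {ϖ : F} (hϖ : IsUniformizer ϖ)
    (σ : E ≃ₐ[F] E) (x : E) : ‖σ x‖ ≤ ‖x‖ := by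
  let _ : NontriviallyNormedField F := NontriviallyNormedField.ofNormNeOne ⟨ϖ, hϖ.1, hϖ.2.1.ne⟩
  let f : E →L[F] E := LinearMap.toContinuousLinearMap σ.toLinearMap
  have hf : ∀ y, ‖σ y‖ ≤ ‖f‖ * ‖y‖ := fun y => f.le_opNorm y
  by_contra! hlt
  have hx : 0 < ‖x‖ := by
    refine norm_pos_iff.2 fun h0 => ?_
    simp [h0] at hlt
  obtain ⟨n, hn⟩ := pow_unbounded_of_one_lt ‖f‖ ((one_lt_div hx).2 hlt)
  have h1 := hf (x ^ n)
  rw [map_pow, norm_pow, norm_pow] at h1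
  rw [div_pow, lt_div_iff₀ (pow_pos hx n)] at hn
  linarith

lemma norm_algEquiv [CompleteSpace F] [FiniteDimensional F E] {ϖ : F} (hϖ : IsUniformizer ϖ)
    (σ : E ≃ₐ[F] E) (x : E) : ‖σ x‖ = ‖x‖ := by
  refine le_antisymm (norm_algEquiv_le hϖ σ x) ?_
  simpa using norm_algEquiv_le hϖ σ.symm (σ x)

/-- The fixed subalgebra is `F` or `E`, as the degree is prime. -/
lemma exists_algebraMap_eq_of_fixed (hE : Module.finrank F E = 2) {σ : E ≃ₐ[F] E}
    (hσ : σ ≠ 1) {y : E} (hy : σ y = y) : ∃ x : F, algebraMap F E x = y := by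
  have : IsSimpleOrder (Subalgebra F E) :=
    Subalgebra.isSimpleOrder_of_finrank_prime F E (by rw [hE]; exact Nat.prime_two)
  have hmem : y ∈ AlgHom.equalizer (σ : E →ₐ[F] E) (AlgHom.id F E) := hy
  rcases eq_bot_or_eq_top (AlgHom.equalizer (σ : E →ₐ[F] E) (AlgHom.id F E)) with h | h
  · rw [h] at hmem
    exact Algebra.mem_bot.1 hmem
  · refine absurd (AlgEquiv.ext fun z => ?_) hσ
    have : z ∈ AlgHom.equalizer (σ : E →ₐ[F] E) (AlgHom.id F E) := by rw [h]; trivial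
    exact this

theorem IsNonsplitRep.exists_ratios [IsUltrametricDist F] [CompleteSpace F]
    (hE : IsUnramifiedQuadratic F E) {σ : E ≃ₐ[F] E} (hσ : σ ≠ 1) {ϖ : F} (hϖ : IsUniformizer ϖ)
    {a b c d : E} {e : F} (h : IsNonsplitRep σ ϖ a b c d e) :
    ∃ κ τ : F, c = algebraMap F E κ * b ∧ d - a = algebraMap F E τ * b ∧ ‖a‖ ≤ 1 ∧ ‖d‖ ≤ 1 ∧
      Odd (ord ϖ b + ord ϖ c) ∧ 0 < ord ϖ b + ord ϖ c := by
  have : FiniteDimensional F E := Module.finite_of_finrank_pos (by rw [hE.1]; norm_num)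
  have : IsUltrametricDist E := isUltrametricDist_of_normedAlgebra F E
  have hm := h.mem_symmetricSpace
  have e00 := congrFun₂ hm 0 0
  have e01 := congrFun₂ hm 0 1
  have e10 := congrFun₂ hm 1 0
  have e11 := congrFun₂ hm 1 1
  simp [Matrix.mul_apply, Fin.sum_univ_two] at e00 e01 e10 e11
  have hb := h.b_ne_zero
  have hc := h.c_ne_zero
  have hσb : σ b ≠ 0 := by simpa using hb
  have hσc : σ c ≠ 0 := by simpa using hc
  -- The off-diagonal equations give `a σ(a) * c σ(b) = d σ(d) * b σ(c)`; substituting `a σ(a) = 1 -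
  -- b σ(c)` and `d σ(d) = 1 - c σ(b)` leaves the claim.
  have hcb : b * σ c = c * σ b := by
    linear_combination (-(a * σ b)) * e10 + (d * σ c) * e01 - (b * σ c) * e11 + (c * σ b) * e00
  have hdb : d * σ b = -(b * σ a) := by
    apply mul_left_cancel₀ hσc
    linear_combination σ b * e10 + σ a * hcb
  obtain ⟨κ, hκ⟩ := exists_algebraMap_eq_of_fixed hE.1 hσ (y := c / b) (by
    rw [map_div₀, div_eq_div_iff hσb hb]; linear_combination hcb)
  obtain ⟨τ, hτ⟩ := exists_algebraMap_eq_of_fixed hE.1 hσ (y := (d - a) / b) (by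
    rw [map_div₀, map_sub, div_eq_div_iff hσb hb]; linear_combination e01 - hdb)
  have hnorm : ‖1 - a * σ a‖ = ‖b‖ * ‖c‖ := by
    rw [show 1 - a * σ a = b * σ c by linear_combination -e00, norm_mul, norm_algEquiv hϖ]
  have hord : ord ϖ (1 - a * σ a) = ord ϖ b + ord ϖ c := by
    apply ord_eq_of_norm_eq hϖ
    rw [hnorm, norm_eq_zpow_ord hE hϖ hb, norm_eq_zpow_ord hE hϖ hc, zpow_add₀ hϖ.norm_pos.ne']
  have hodd := h.odd_ord
  have haa : ‖a * σ a‖ = ‖a‖ ^ 2 := by rw [norm_mul, norm_algEquiv hϖ, pow_two]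
  have ha : ‖a‖ ≤ 1 := by
    -- If `a` were not integral, `1 - a σ(a)` would have the even valuation `2 v(a)`.
    by_contra! hlt
    have h0 : a ≠ 0 := norm_pos_iff.1 (zero_lt_one.trans hlt)
    have h1 : ‖1 - a * σ a‖ = ‖a‖ ^ 2 := by
      rw [norm_sub_eq_of_lt (by rw [haa, norm_one]; nlinarith), haa]
    have h2 : ord ϖ (1 - a * σ a) = 2 * ord ϖ a := by
      apply ord_eq_of_norm_eq hϖ
      rw [h1, norm_eq_zpow_ord hE hϖ h0, ← zpow_natCast, ← zpow_mul, mul_comm]; rfl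
    rw [h2] at hodd
    exact (Int.not_odd_iff_even.2 (even_two_mul _)) hodd
  refine ⟨κ, τ, by rw [hκ]; field_simp, by rw [hτ]; field_simp, ha, ?_, hord ▸ hodd, ?_⟩
  · have h1 : ‖d * σ b‖ = ‖b * σ a‖ := by rw [hdb, norm_neg]
    rw [norm_mul, norm_mul, norm_algEquiv hϖ, norm_algEquiv hϖ, mul_comm] at h1
    rw [mul_left_cancel₀ (norm_ne_zero_iff.2 hb) h1]; exact ha
  · have hle : ‖1 - a * σ a‖ ≤ 1 := by
      rw [sub_eq_add_neg]
      refine (IsUltrametricDist.norm_add_le_max _ _).trans (max_le norm_one.le ?_)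
      rw [norm_neg, haa]; exact pow_le_one₀ (norm_nonneg _) ha
    have h0 : 1 - a * σ a ≠ 0 := by
      rw [← norm_ne_zero_iff, hnorm]
      exact mul_ne_zero (norm_ne_zero_iff.2 hb) (norm_ne_zero_iff.2 hc)
    rw [norm_eq_zpow_ord hE hϖ h0, ← zpow_zero ‖ϖ‖, hϖ.zpow_le_zpow, hord] at hle
    rw [hord] at hodd
    obtain ⟨k, hk⟩ := hodd
    omega

end Extension

/-! ### Support of the integrand in Iwasawa coordinates -/

section Integrand

variable {F : Type*} [NormedField F] {E : Type*} [NormedField E] [NormedAlgebra F E]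

/-- The orbit point `h • (γ, u, vᵀ)` lies in the support of the test function. -/
def InSupport {n : ℕ} (σ : E ≃ₐ[F] E) (ϖ : F) (r : ℕ) (γ : Matrix (Fin n) (Fin n) E)
    (u v : Fin n → F) (h : Matrix.GeneralLinearGroup (Fin n) F) : Prop :=
  conj h γ ∈ boundedSymmetric σ ϖ r ∧ (∀ i, ‖(h.val.mulVec u) i‖ ≤ 1) ∧
    ∀ i, ‖(Matrix.vecMul v (h⁻¹).val) i‖ ≤ 1

open Classical in
lemma orbIntegrand_eq_ite [IsUltrametricDist F] {n : ℕ} (σ : E ≃ₐ[F] E) (ϖ : F) (r : ℕ)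
    (γ : Matrix (Fin n) (Fin n) E) (u v : Fin n → F) (s : ℂ)
    (h : Matrix.GeneralLinearGroup (Fin n) F) :
    orbIntegrand ϖ (testFn σ ϖ r) γ u v s h =
      if InSupport σ ϖ r γ u v h then eta ϖ h.val.det * ((normAbs ϖ h.val.det : ℝ) : ℂ) ^ (-s)
      else 0 := by
  by_cases hA : conj h γ ∈ boundedSymmetric σ ϖ r
  · by_cases hB : (h.val.mulVec u, Matrix.vecMul v (h⁻¹).val) ∈
      {w : (Fin n → F) × (Fin n → F) | (∀ i, ‖w.1 i‖ ≤ 1) ∧ ∀ i, ‖w.2 i‖ ≤ 1}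
    · rw [if_pos ⟨hA, hB⟩, orbIntegrand, testFn, latticeIndicator, Set.indicator_of_mem hA,
        Set.indicator_of_mem hB]
      simp only [Pi.one_apply, one_mul]
    · rw [if_neg fun h => hB h.2, orbIntegrand, latticeIndicator, Set.indicator_of_notMem hB]
      simp only [mul_zero, zero_mul]
  · rw [if_neg fun h => hA h.1, orbIntegrand, testFn, Set.indicator_of_notMem hA]
    simp only [zero_mul]

lemma conj_mul {n : ℕ} (k h : Matrix.GeneralLinearGroup (Fin n) F) (γ : Matrix (Fin n) (Fin n) E) :
    conj (k * h) γ = conj k (conj h γ) := by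
  simp only [conj, mul_inv_rev, Units.val_mul, Matrix.map_mul, mul_assoc]

lemma conj_mem_symmetricSpace {n : ℕ} {σ : E ≃ₐ[F] E} (h : Matrix.GeneralLinearGroup (Fin n) F)
    {γ : Matrix (Fin n) (Fin n) E} (hγ : γ ∈ symmetricSpace σ) :
    conj h γ ∈ symmetricSpace σ := by
  have hmap : ∀ A : Matrix (Fin n) (Fin n) F,
      (A.map (algebraMap F E)).map σ = A.map (algebraMap F E) := by
    intro A; ext i j; simp
  have hinv : (h⁻¹).val.map (algebraMap F E) * h.val.map (algebraMap F E) = 1 := by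
    rw [← Matrix.map_mul, ← Units.val_mul, inv_mul_cancel, Units.val_one,
      Matrix.map_one _ (map_zero _) (map_one _)]
  have hinv' : h.val.map (algebraMap F E) * (h⁻¹).val.map (algebraMap F E) = 1 := by
    rw [← Matrix.map_mul, ← Units.val_mul, mul_inv_cancel, Units.val_one,
      Matrix.map_one _ (map_zero _) (map_one _)]
  have hγ' : γ * γ.map σ = 1 := hγ
  change conj h γ * (conj h γ).map σ = 1
  rw [conj, Matrix.map_mul, Matrix.map_mul, hmap, hmap]
  calc _ = h.val.map (algebraMap F E) * (γ * ((h⁻¹).val.map (algebraMap F E) *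
        h.val.map (algebraMap F E)) * γ.map σ) * (h⁻¹).val.map (algebraMap F E) := by
        simp only [mul_assoc]
    _ = 1 := by rw [hinv, mul_one, hγ', mul_one, hinv']

variable [IsUltrametricDist F]

lemma InSupport.mul_left {n : ℕ} {σ : E ≃ₐ[F] E} {ϖ : F} {r : ℕ}
    {γ : Matrix (Fin n) (Fin n) E} {u v : Fin n → F} {k h : Matrix.GeneralLinearGroup (Fin n) F}
    (hk : k ∈ integralSubgroup F n) (hh : InSupport σ ϖ r γ u v h) :
    InSupport σ ϖ r γ u v (k * h) := by
  have : IsUltrametricDist E := isUltrametricDist_of_normedAlgebra F E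
  obtain ⟨⟨h1, h2⟩, h3, h4⟩ := hh
  refine ⟨⟨?_, fun i j => ?_⟩, fun i => ?_, fun i => ?_⟩
  · rw [conj_mul]; exact conj_mem_symmetricSpace k h1
  · rw [conj_mul]
    have e1 : algebraMap F E ϖ ^ r * conj k (conj h γ) i j =
        (k.val.map (algebraMap F E) * (algebraMap F E ϖ ^ r • conj h γ) *
          (k⁻¹).val.map (algebraMap F E)) i j := by
      rw [Matrix.mul_smul, Matrix.smul_mul]; rfl
    rw [e1]
    refine norm_mul_apply_le_one (norm_mul_apply_le_one (fun i j => ?_) fun i j => ?_)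
      (fun i j => ?_) i j
    · rw [Matrix.map_apply, norm_algebraMap']; exact (hk i j).1
    · exact h2 i j
    · rw [Matrix.map_apply, norm_algebraMap']; exact (hk i j).2
  · rw [Units.val_mul, ← Matrix.mulVec_mulVec, Matrix.mulVec, dotProduct]
    refine IsUltrametricDist.norm_sum_le_of_forall_le_of_nonneg zero_le_one fun j _ => ?_
    rw [norm_mul]
    exact mul_le_one₀ (hk i j).1 (norm_nonneg _) (h3 j)
  · rw [mul_inv_rev, Units.val_mul, ← Matrix.vecMul_vecMul, Matrix.vecMul, dotProduct]
    refine IsUltrametricDist.norm_sum_le_of_forall_le_of_nonneg zero_le_one fun j _ => ?_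
    rw [norm_mul]
    exact mul_le_one₀ (h4 j) (norm_nonneg _) (hk j i).2

lemma inSupport_mul_left_iff {n : ℕ} {σ : E ≃ₐ[F] E} {ϖ : F} {r : ℕ}
    {γ : Matrix (Fin n) (Fin n) E} {u v : Fin n → F} {k h : Matrix.GeneralLinearGroup (Fin n) F}
    (hk : k ∈ integralSubgroup F n) :
    InSupport σ ϖ r γ u v (k * h) ↔ InSupport σ ϖ r γ u v h := by
  refine ⟨fun hh => ?_, fun hh => hh.mul_left hk⟩
  simpa using hh.mul_left (inv_mem hk)

omit [NormedAlgebra F E] [NormedField E] in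
lemma norm_det_of_mem_integralSubgroup {k : Matrix.GeneralLinearGroup (Fin 2) F}
    (hk : k ∈ integralSubgroup F 2) : ‖k.val.det‖ = 1 := by
  have hle : ∀ k : Matrix.GeneralLinearGroup (Fin 2) F, k ∈ integralSubgroup F 2 →
      ‖k.val.det‖ ≤ 1 := by
    intro k hk
    rw [Matrix.det_fin_two, sub_eq_add_neg]
    refine (IsUltrametricDist.norm_add_le_max _ _).trans (max_le ?_ ?_)
    · rw [norm_mul]; exact mul_le_one₀ (hk 0 0).1 (norm_nonneg _) (hk 1 1).1
    · rw [norm_neg, norm_mul]; exact mul_le_one₀ (hk 0 1).1 (norm_nonneg _) (hk 1 0).1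
  have h1 := hle k hk
  have h2 := hle _ (inv_mem hk)
  have h3 : ‖k.val.det‖ * ‖(k⁻¹).val.det‖ = 1 := by
    rw [← norm_mul, ← Matrix.det_mul, ← Units.val_mul, mul_inv_cancel, Units.val_one,
      Matrix.det_one, norm_one]
  nlinarith [norm_nonneg k.val.det]

omit [NormedAlgebra F E] [NormedField E] in
lemma ord_det_mul_upper {ϖ : F} (hϖ : IsUniformizer ϖ)
    {k : Matrix.GeneralLinearGroup (Fin 2) F} (hk : k ∈ integralSubgroup F 2) (m n : ℤ) (x : F) :
    ord ϖ (k * upper (hϖ.unit ^ m) (hϖ.unit ^ n) x).val.det = m + n := by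
  apply ord_eq_of_norm_eq hϖ
  rw [Units.val_mul, Matrix.det_mul, norm_mul, norm_det_of_mem_integralSubgroup hk, one_mul,
    coe_upper, Matrix.det_fin_two_of, mul_zero, sub_zero, hϖ.coe_unit_zpow, hϖ.coe_unit_zpow,
    norm_mul, norm_zpow, norm_zpow, zpow_add₀ hϖ.norm_pos.ne']

omit [IsUltrametricDist F] in
lemma conj_upper {ϖ : F} (hϖ : IsUniformizer ϖ) {a b c d : E} {κ τ : F}
    (hc : c = algebraMap F E κ * b) (hτ : d - a = algebraMap F E τ * b) (m n : ℤ) (x : F) :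
    conj (upper (hϖ.unit ^ m) (hϖ.unit ^ n) x) !![a, b; c, d] =
      !![a + algebraMap F E x * c / algebraMap F E ϖ ^ m,
        b * algebraMap F E ((ϖ ^ m) ^ 2 + τ * ϖ ^ m * x - κ * x ^ 2) /
          (algebraMap F E ϖ ^ m * algebraMap F E ϖ ^ n);
        algebraMap F E ϖ ^ n * c / algebraMap F E ϖ ^ m,
        d + -(algebraMap F E x * c / algebraMap F E ϖ ^ m)] := by
  have hϖ0 : algebraMap F E ϖ ≠ 0 := by simpa using hϖ.1
  have hα0 : algebraMap F E ϖ ^ m ≠ 0 := zpow_ne_zero _ hϖ0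
  have hβ0 : algebraMap F E ϖ ^ n ≠ 0 := zpow_ne_zero _ hϖ0
  have hd' : d = a + algebraMap F E τ * b := by linear_combination hτ
  rw [conj, coe_upper, coe_upper_inv, hϖ.coe_unit_zpow, hϖ.coe_unit_zpow]
  ext i j
  fin_cases i <;> fin_cases j <;> simp [Matrix.mul_apply, Fin.sum_univ_two, hc, hd'] <;>
  field_simp <;> ring

/-- The two vectors give `‖x‖ ≤ 1` and `0 ≤ n ≤ v(e)`; the lower left entry of the conjugate bounds
`m`. As `a` and `d` are integral, both diagonal entries impose the same bound on `x`, and the upper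
right entry is the quadratic condition. -/
lemma inSupport_upper_iff {σ : E ≃ₐ[F] E} {ϖ : F} (hϖ : IsUniformizer ϖ) {r : ℕ}
    {a b c d : E} {e κ τ : F} {B C : ℤ} (hγ : !![a, b; c, d] ∈ symmetricSpace σ)
    (hc : c = algebraMap F E κ * b) (hτ : d - a = algebraMap F E τ * b) (ha : ‖a‖ ≤ 1)
    (hd : ‖d‖ ≤ 1) (hB : ‖b‖ = ‖ϖ‖ ^ B) (hC : ‖c‖ = ‖ϖ‖ ^ C) (he : e ≠ 0) (m n : ℤ) (x : F) :
    InSupport σ ϖ r !![a, b; c, d] ![0, 1] ![0, e] (upper (hϖ.unit ^ m) (hϖ.unit ^ n) x) ↔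
      0 ≤ n ∧ n ≤ ord ϖ e ∧ m ≤ n + C + r ∧ x ∈ admissible ϖ κ τ r B C m n := by
  have : IsUltrametricDist E := isUltrametricDist_of_normedAlgebra F E
  have hp := hϖ.norm_pos
  have hconj := conj_upper hϖ hc hτ m n x
  have hf : ∀ y : F, ‖algebraMap F E y‖ = ‖y‖ := fun y => norm_algebraMap' E y
  obtain ⟨f, hfdef⟩ : ∃ f, f = algebraMap F E := ⟨_, rfl⟩
  rw [← hfdef] at hconj hf
  have hsum : ∀ y z : E, ‖y‖ ≤ 1 → (‖f ϖ ^ r * (y + z)‖ ≤ 1 ↔ ‖f ϖ ^ r * z‖ ≤ 1) := by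
    intro y z hy
    have h1 : ‖f ϖ ^ r * y‖ ≤ 1 := by
      rw [norm_mul, norm_pow, hf]
      exact mul_le_one₀ (pow_le_one₀ hp.le hϖ.2.1.le) (norm_nonneg _) hy
    constructor
    · intro h
      rw [show f ϖ ^ r * z = f ϖ ^ r * (y + z) + -(f ϖ ^ r * y) by ring]
      exact (IsUltrametricDist.norm_add_le_max _ _).trans (max_le h (by rwa [norm_neg]))
    · intro h
      rw [mul_add]
      exact (IsUltrametricDist.norm_add_le_max _ _).trans (max_le h1 h)
  have hle1 : ∀ k : ℤ, ‖ϖ‖ ^ k ≤ 1 ↔ 0 ≤ k := fun k => by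
    rw [← zpow_zero ‖ϖ‖, hϖ.zpow_le_zpow]
  have hshift : ∀ (t : ℝ) (i j : ℤ), i = -j → (t * ‖ϖ‖ ^ i ≤ 1 ↔ t ≤ ‖ϖ‖ ^ j) := by
    rintro t i j rfl
    rw [← le_div_iff₀ (zpow_pos hp _), zpow_neg, one_div, inv_inv]
  have c1 : ‖f ϖ ^ r * (f x * c / f ϖ ^ m)‖ ≤ 1 ↔ ‖x‖ ≤ ‖ϖ‖ ^ (m - C - r) := by
    rw [← hshift _ (r + C - m) _ (by ring), zpow_sub₀ hp.ne', zpow_add₀ hp.ne', zpow_natCast]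
    simp only [norm_mul, norm_div, norm_pow, norm_zpow, hf, hC]
    ring_nf
  have c2 : ‖f ϖ ^ r * (b * f ((ϖ ^ m) ^ 2 + τ * ϖ ^ m * x - κ * x ^ 2) /
      (f ϖ ^ m * f ϖ ^ n))‖ ≤ 1 ↔
      ‖(ϖ ^ m) ^ 2 + τ * ϖ ^ m * x - κ * x ^ 2‖ ≤ ‖ϖ‖ ^ (m + n - r - B) := by
    rw [← hshift _ (r + B - (m + n)) _ (by ring), zpow_sub₀ hp.ne', zpow_add₀ hp.ne',
      zpow_add₀ hp.ne', zpow_natCast, norm_mul, norm_div, norm_mul b, hf]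
    simp only [norm_mul, norm_pow, norm_zpow, hf, hB]
    ring_nf
  have c3 : ‖f ϖ ^ r * (f ϖ ^ n * c / f ϖ ^ m)‖ ≤ 1 ↔ m ≤ n + C + r := by
    have : ‖f ϖ ^ r * (f ϖ ^ n * c / f ϖ ^ m)‖ = ‖ϖ‖ ^ (r + n + C - m : ℤ) := by
      rw [zpow_sub₀ hp.ne', zpow_add₀ hp.ne', zpow_add₀ hp.ne', zpow_natCast]
      simp only [norm_mul, norm_div, norm_pow, norm_zpow, hf, hC]
      ring
    rw [this, hle1]
    omega
  have c4 : ‖e * ϖ ^ (-n)‖ ≤ 1 ↔ n ≤ ord ϖ e := by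
    rw [norm_mul, norm_zpow, norm_eq_zpow_ord_self hϖ he, ← zpow_add₀ hp.ne', hle1]
    omega
  have hu : (upper (hϖ.unit ^ m) (hϖ.unit ^ n) x).val.mulVec ![0, 1] = ![x, ϖ ^ n] := by
    rw [coe_upper, hϖ.coe_unit_zpow, hϖ.coe_unit_zpow]
    ext i; fin_cases i <;> simp [Matrix.mulVec, dotProduct]
  have hv : Matrix.vecMul ![0, e] ((upper (hϖ.unit ^ m) (hϖ.unit ^ n) x)⁻¹).val =
      ![0, e * ϖ ^ (-n)] := by
    rw [coe_upper_inv, hϖ.coe_unit_zpow, hϖ.coe_unit_zpow]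
    ext i; fin_cases i <;> simp [Matrix.vecMul, dotProduct]
  have key : InSupport σ ϖ r !![a, b; c, d] ![0, 1] ![0, e]
      (upper (hϖ.unit ^ m) (hϖ.unit ^ n) x) ↔
      (‖x‖ ≤ ‖ϖ‖ ^ (m - C - r) ∧
        ‖(ϖ ^ m) ^ 2 + τ * ϖ ^ m * x - κ * x ^ 2‖ ≤ ‖ϖ‖ ^ (m + n - r - B) ∧ m ≤ n + C + r) ∧
      (‖x‖ ≤ 1 ∧ 0 ≤ n) ∧ n ≤ ord ϖ e := by
    rw [InSupport, hu, hv, boundedSymmetric, Set.mem_ofPred_eq,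
      and_iff_right (conj_mem_symmetricSpace _ hγ), hconj, ← hfdef, ← c1, ← c2, ← c3, ← c4, ← hle1 n]
    simp only [Fin.forall_fin_two, Matrix.of_apply, Matrix.cons_val', Matrix.cons_val_zero,
      Matrix.cons_val_one, hsum _ _ ha, hsum _ _ hd, norm_zero, zero_le_one, true_and, mul_neg,
      norm_neg, norm_zpow]
    tauto
  rw [key]
  simp only [admissible, Set.mem_ofPred_eq]
  tauto

end Integrand

/-! ### The orbital integral as a finite sum and its derivative -/

section Orbital

variable {F : Type*} [NormedField F] [IsUltrametricDist F] [ProperSpace F]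
  {E : Type*} [NormedField E] [NormedAlgebra F E]

/-- The value of `η(x) |x|^{-s}` at an element `x` of valuation `k`. -/
def weight (q : ℕ) (s : ℂ) (k : ℤ) : ℂ := (-1) ^ k * (((q : ℝ) ^ (-k) : ℝ) : ℂ) ^ (-s)

lemma hasDerivAt_weight {q : ℕ} (hq : 1 < q) (k : ℤ) :
    HasDerivAt (fun s => weight q s k) ((-1) ^ k * (k * Real.log q)) 0 := by
  have hq0 : (0 : ℝ) < q := by positivity
  have hy : (((q : ℝ) ^ (-k) : ℝ) : ℂ) ≠ 0 := by
    exact_mod_cast (zpow_pos hq0 _).ne'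
  have h := ((hasDerivAt_neg (0 : ℂ)).const_cpow (c := (((q : ℝ) ^ (-k) : ℝ) : ℂ))
    (Or.inl hy)).const_mul ((-1 : ℂ) ^ k)
  refine h.congr_deriv ?_
  rw [neg_zero, Complex.cpow_zero, one_mul, ← Complex.ofReal_log (zpow_pos hq0 _).le, Real.log_zpow]
  push_cast
  ring

omit [ProperSpace F] in
open Classical in
lemma orbIntegrand_eq_sum {σ : E ≃ₐ[F] E} {ϖ : F} (hϖ : IsUniformizer ϖ) {r : ℕ}
    {a b c d : E} {e κ τ : F} {B C : ℤ} (hγ : !![a, b; c, d] ∈ symmetricSpace σ)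
    (hc : c = algebraMap F E κ * b) (hτ : d - a = algebraMap F E τ * b) (ha : ‖a‖ ≤ 1)
    (hd : ‖d‖ ≤ 1) (hB : ‖b‖ = ‖ϖ‖ ^ B) (hC : ‖c‖ = ‖ϖ‖ ^ C) (he : e ≠ 0)
    (hκ : ‖κ‖ = ‖ϖ‖ ^ (C - B)) (hτ' : ‖τ‖ ≤ ‖ϖ‖ ^ (-B)) (L : ℕ → ℕ)
    (hL : ∀ n i, L n ≤ i → admissible ϖ κ τ r B C (r + C + n - i) n = ∅)
    (s : ℂ) (h : Matrix.GeneralLinearGroup (Fin 2) F) :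
    orbIntegrand ϖ (testFn σ ϖ r) !![a, b; c, d] ![0, 1] ![0, e] s h =
      ∑ n ∈ Finset.range (ord ϖ e + 1).toNat, ∑ i ∈ Finset.range (L n),
        (cell (hϖ.unit ^ (r + C + n - i)) (hϖ.unit ^ (n : ℤ))
          (admissible ϖ κ τ r B C (r + C + n - i) n)).indicator
          (fun _ => weight (residueCard F) s (r + C + 2 * n - i)) h := by
  obtain ⟨k, hk, m, n, x, rfl⟩ := exists_mul_upper hϖ h
  rw [orbIntegrand_eq_ite, inSupport_mul_left_iff hk,
    inSupport_upper_iff hϖ hγ hc hτ ha hd hB hC he, eta, normAbs, ord_det_mul_upper hϖ hk]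
  have hmem : ∀ n' i : ℕ, k * upper (hϖ.unit ^ m) (hϖ.unit ^ n) x ∈
      cell (hϖ.unit ^ (r + C + n' - i)) (hϖ.unit ^ (n' : ℤ))
          (admissible ϖ κ τ r B C (r + C + n' - i) n') ↔
      m = r + C + n' - i ∧ n = n' ∧ x ∈ admissible ϖ κ τ r B C (r + C + n' - i) n' := by
    intro n' i
    refine mul_upper_mem_cell_iff hϖ (fun y y' hy => ?_) hk
    exact ⟨add_mem_admissible_iff hϖ hκ hτ' (by omega) (by omega) hy,
      add_mem_admissible_iff hϖ hκ hτ' (by omega) (by omega) (by rwa [norm_sub_rev])⟩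
  simp only [Set.indicator_apply, hmem]
  split_ifs with hsupp
  · obtain ⟨h1, h2, h3, h4⟩ := hsupp
    obtain ⟨n, rfl⟩ := Int.eq_ofNat_of_zero_le h1
    obtain ⟨i, hi⟩ := Int.eq_ofNat_of_zero_le (show 0 ≤ r + C + n - m by omega)
    obtain rfl : m = r + C + n - i := by omega
    have hiL : i < L n := by
      by_contra! hle
      rw [hL n i hle] at h4
      exact h4
    rw [Finset.sum_eq_single n, Finset.sum_eq_single i, if_pos ⟨rfl, rfl, h4⟩, weight]
    · rw [show (r + C + n - i + n : ℤ) = r + C + 2 * n - i by ring]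
    · exact fun j _ hj => if_neg fun hcon => hj (by omega)
    · exact fun hcon => absurd (Finset.mem_range.2 hiL) hcon
    · exact fun n' _ hn' => Finset.sum_eq_zero fun j _ => if_neg fun hcon => hn' (by omega)
    · exact fun hcon => absurd (Finset.mem_range.2 (by omega)) hcon
  · symm
    refine Finset.sum_eq_zero fun n' hn' => Finset.sum_eq_zero fun i _ => if_neg ?_
    rintro ⟨rfl, rfl, hx⟩
    have := Finset.mem_range.1 hn'
    exact hsupp ⟨by omega, by omega, by omega, hx⟩

variable [MeasurableSpace (Matrix.GeneralLinearGroup (Fin 2) F)]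
  [BorelSpace (Matrix.GeneralLinearGroup (Fin 2) F)]
  (μ : Measure (Matrix.GeneralLinearGroup (Fin 2) F)) [μ.IsHaarMeasure]

omit [μ.IsHaarMeasure] in
-- Finitely many cells of finite volume carry the integrand, and on each it is a constant
-- exponential in `s`, so integrability holds for every `s` and the derivative is termwise.
lemma orbital_integral {σ : E ≃ₐ[F] E} {ϖ : F} (hϖ : IsUniformizer ϖ) {r : ℕ}
    {a b c d : E} {e κ τ : F} {B C : ℤ} (hγ : !![a, b; c, d] ∈ symmetricSpace σ)
    (hc : c = algebraMap F E κ * b) (hτ : d - a = algebraMap F E τ * b) (ha : ‖a‖ ≤ 1)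
    (hd : ‖d‖ ≤ 1) (hB : ‖b‖ = ‖ϖ‖ ^ B) (hC : ‖c‖ = ‖ϖ‖ ^ C) (he : e ≠ 0)
    (hκ : ‖κ‖ = ‖ϖ‖ ^ (C - B)) (hτ' : ‖τ‖ ≤ ‖ϖ‖ ^ (-B)) (L : ℕ → ℕ) (N : ℕ → ℕ → ℕ)
    (hL : ∀ n i, L n ≤ i → admissible ϖ κ τ r B C (r + C + n - i) n = ∅)
    (hN : ∀ n i, i < L n → μ (cell (hϖ.unit ^ (r + C + n - i)) (hϖ.unit ^ (n : ℤ))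
      (admissible ϖ κ τ r B C (r + C + n - i) n)) = N n i) :
    (∀ s : ℂ, Integrable
      (orbIntegrand ϖ (testFn σ ϖ r) !![a, b; c, d] ![0, 1] ![0, e] s) μ) ∧
    HasDerivAt (weightedOrb μ ϖ (testFn σ ϖ r) !![a, b; c, d] ![0, 1] ![0, e])
      ((-1) ^ (r + C) * Real.log (residueCard F) *
        ((∑ n ∈ Finset.range (ord ϖ e + 1).toNat, ∑ i ∈ Finset.range (L n),
          (-1) ^ i * ((r + C + 2 * n : ℚ) - i) * (N n i : ℚ) : ℚ) : ℂ)) 0 := by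
  have hfun : ∀ s, orbIntegrand ϖ (testFn σ ϖ r) !![a, b; c, d] ![0, 1] ![0, e] s = _ := fun s =>
    funext (orbIntegrand_eq_sum hϖ hγ hc hτ ha hd hB hC he hκ hτ' L hL s)
  have hint : ∀ s : ℂ, ∀ n, ∀ i ∈ Finset.range (L n), Integrable
      ((cell (hϖ.unit ^ (r + C + n - i)) (hϖ.unit ^ (n : ℤ))
          (admissible ϖ κ τ r B C (r + C + n - i) n)).indicator
          (fun _ => weight (residueCard F) s (r + C + 2 * n - i))) μ := by
    intro s n i hi
    rw [integrable_indicator_iff (isOpen_cell _ _ _).measurableSet]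
    refine integrableOn_const ?_
    rw [hN n i (Finset.mem_range.1 hi)]
    exact ENNReal.natCast_ne_top _
  refine ⟨fun s => ?_, ?_⟩
  · rw [hfun]
    exact integrable_finsetSum _ fun n _ => integrable_finsetSum _ fun i hi => hint s n i hi
  · have horb : weightedOrb μ ϖ (testFn σ ϖ r) !![a, b; c, d] ![0, 1] ![0, e] = fun s =>
        ∑ n ∈ Finset.range (ord ϖ e + 1).toNat, ∑ i ∈ Finset.range (L n),
          (N n i : ℂ) * weight (residueCard F) s (r + C + 2 * n - i) := by
      funext s
      rw [weightedOrb, hfun, integral_finsetSum _ fun n _ =>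
        integrable_finsetSum _ fun i hi => hint s n i hi]
      refine Finset.sum_congr rfl fun n _ => ?_
      rw [integral_finsetSum _ fun i hi => hint s n i hi]
      refine Finset.sum_congr rfl fun i hi => ?_
      rw [integral_indicator (isOpen_cell _ _ _).measurableSet, setIntegral_const, measureReal_def,
        hN n i (Finset.mem_range.1 hi), ENNReal.toReal_natCast]
      simp
    rw [horb]
    have hder : HasDerivAt (fun s => ∑ n ∈ Finset.range (ord ϖ e + 1).toNat,
        ∑ i ∈ Finset.range (L n), (N n i : ℂ) * weight (residueCard F) s (r + C + 2 * n - i)) _ 0 :=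
      HasDerivAt.fun_sum fun n _ => HasDerivAt.fun_sum fun i _ =>
        (hasDerivAt_weight (one_lt_residueCard (F := F)) (r + C + 2 * n - i)).const_mul (N n i : ℂ)
    convert hder using 1
    push_cast
    rw [Finset.mul_sum]
    refine Finset.sum_congr rfl fun n _ => ?_
    rw [Finset.mul_sum]
    refine Finset.sum_congr rfl fun i _ => ?_
    have hsign : (-1 : ℂ) ^ (r + C + 2 * n - i : ℤ) = (-1) ^ (r + C) * (-1) ^ i := by
      have h1 : (-1 : ℂ) ≠ 0 := by norm_num
      rw [zpow_sub₀ h1, zpow_add₀ h1, zpow_mul, zpow_natCast _ i]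
      rcases neg_one_pow_eq_or ℂ i with h | h <;> rw [h] <;> norm_num [div_neg]
    rw [hsign]
    ring

end Orbital

/-! ### Valuations of the ratios `κ` and `τ` -/

section Normalized

variable {F : Type*} [NormedField F] [IsUltrametricDist F] [CompleteSpace F]
  {E : Type*} [NormedField E] [NormedAlgebra F E]

lemma IsNonsplitRep.exists_normalized (hE : IsUnramifiedQuadratic F E) {σ : E ≃ₐ[F] E} (hσ : σ ≠ 1)
    {ϖ : F} (hϖ : IsUniformizer ϖ) {a b c d : E} {e : F} (h : IsNonsplitRep σ ϖ a b c d e) :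
    ∃ κ τ : F, c = algebraMap F E κ * b ∧ d - a = algebraMap F E τ * b ∧ ‖a‖ ≤ 1 ∧ ‖d‖ ≤ 1 ∧
      ‖b‖ = ‖ϖ‖ ^ ord ϖ b ∧ ‖c‖ = ‖ϖ‖ ^ ord ϖ c ∧ ‖κ‖ = ‖ϖ‖ ^ (ord ϖ c - ord ϖ b) ∧
      ‖τ‖ ≤ ‖ϖ‖ ^ (-ord ϖ b) ∧
      (d - a ≠ 0 → 0 ≤ ord ϖ (d - a) ∧ ‖τ‖ = ‖ϖ‖ ^ (ord ϖ (d - a) - ord ϖ b)) := by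
  obtain ⟨κ, τ, hc, hτ, ha, hd, -, -⟩ := h.exists_ratios hE hσ hϖ
  have : IsUltrametricDist E := isUltrametricDist_of_normedAlgebra F E
  have hb := norm_eq_zpow_ord hE hϖ h.b_ne_zero
  have hc' := norm_eq_zpow_ord hE hϖ h.c_ne_zero
  have hb0 := norm_pos_iff.2 h.b_ne_zero
  have hp := hϖ.norm_pos
  have hda : ‖d - a‖ ≤ 1 := by
    rw [sub_eq_add_neg]
    exact (IsUltrametricDist.norm_add_le_max _ _).trans (max_le hd (by rwa [norm_neg]))
  have hκn : ‖κ‖ = ‖c‖ / ‖b‖ := by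
    rw [hc, norm_mul, norm_algebraMap', mul_div_cancel_right₀ _ hb0.ne']
  have hτn : ‖τ‖ = ‖d - a‖ / ‖b‖ := by
    rw [hτ, norm_mul, norm_algebraMap', mul_div_cancel_right₀ _ hb0.ne']
  refine ⟨κ, τ, hc, hτ, ha, hd, hb, hc', ?_, ?_, fun h0 => ?_⟩
  · rw [hκn, zpow_sub₀ hp.ne', ← hb, ← hc']
  · rw [hτn, zpow_neg, ← hb, ← one_div]
    gcongr
  · have hn := norm_eq_zpow_ord hE hϖ h0
    refine ⟨?_, by rw [hτn, zpow_sub₀ hp.ne', ← hb, ← hn]⟩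
    rw [hn, ← zpow_zero ‖ϖ‖, hϖ.zpow_le_zpow] at hda
    exact hda

end Normalized

/-! ### The two regimes for `v(d - a)` -/

section Nonsplit

variable {F : Type*} [NormedField F] [IsUltrametricDist F] [ProperSpace F]
  {E : Type*} [NormedField E] [NormedAlgebra F E]
  [MeasurableSpace (Matrix.GeneralLinearGroup (Fin 2) F)]
  [BorelSpace (Matrix.GeneralLinearGroup (Fin 2) F)]
  (μ : Measure (Matrix.GeneralLinearGroup (Fin 2) F)) [μ.IsHaarMeasure]

lemma orbital_integral_large (hE : IsUnramifiedQuadratic F E) {σ : E ≃ₐ[F] E} (hσ : σ ≠ 1) {ϖ : F}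
    (hϖ : IsUniformizer ϖ) (h2 : (2 : F) ≠ 0) (hμ : μ (integralGL 2 F) = 1) (r : ℕ)
    {a b c d : E} {e : F} (h : IsNonsplitRep σ ϖ a b c d e) {M : ℕ}
    (hM : ord ϖ b + ord ϖ c + 2 * r = 2 * M + 1)
    (hda : d - a ≠ 0 → ord ϖ b + ord ϖ c < 2 * ord ϖ (d - a)) :
    (∀ s : ℂ, Integrable
      (orbIntegrand ϖ (testFn σ ϖ r) !![a, b; c, d] ![0, 1] ![0, e] s) μ) ∧
    HasDerivAt (weightedOrb μ ϖ (testFn σ ϖ r) !![a, b; c, d] ![0, 1] ![0, e])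
      ((-1) ^ (r + ord ϖ c) * Real.log (residueCard F) *
        ((∑ n ∈ Finset.range (ord ϖ e + 1).toNat, ∑ i ∈ Finset.range (2 * (M + 1)),
          (-1) ^ i * ((r + ord ϖ c + 2 * n : ℚ) - i) *
            (residueCard F : ℚ) ^ min n (i / 2) : ℚ) : ℂ)) 0 := by
  obtain ⟨κ, τ, hc, hτ, ha, hd, hb, hc', hκ, hτ', hτn⟩ := h.exists_normalized hE hσ hϖ
  -- This is the least integer exceeding half of `v(b) + v(c)`, hence a lower bound for `v(d - a)`
  -- that also covers `d = a`.
  have hD : ∃ D : ℤ, 2 * D = ord ϖ b + ord ϖ c + 1 := ⟨M + 1 - r, by omega⟩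
  obtain ⟨D, hD⟩ := hD
  have hτD : ‖τ‖ ≤ ‖ϖ‖ ^ (D - ord ϖ b) := by
    by_cases hz : d - a = 0
    · have : τ = 0 := by
        rw [hz] at hτ
        simpa [h.b_ne_zero] using hτ.symm
      rw [this, norm_zero]
      exact (zpow_pos hϖ.norm_pos _).le
    · rw [(hτn hz).2, hϖ.zpow_le_zpow]
      have := hda hz
      omega
  have := orbital_integral μ hϖ h.mem_symmetricSpace hc hτ ha hd hb hc' h.e_ne_zero hκ hτ'
    (fun _ => 2 * (M + 1)) (fun n i => residueCard F ^ min n (i / 2))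
    (fun n i hi => admissible_eq_empty (r := r) hϖ hκ hD hτD (by omega))
    (fun n i hi => measure_cell_of_large (r := r) μ h2 hϖ hμ hκ hD hτD (by omega))
  simpa only [Nat.cast_pow] using this

lemma orbital_integral_small (hE : IsUnramifiedQuadratic F E) {σ : E ≃ₐ[F] E} (hσ : σ ≠ 1) {ϖ : F}
    (hϖ : IsUniformizer ϖ) (h2 : (2 : F) ≠ 0) (hμ : μ (integralGL 2 F) = 1) (r : ℕ)
    {a b c d : E} {e : F} (h : IsNonsplitRep σ ϖ a b c d e) {D : ℕ}
    (hD : 2 * D < ord ϖ b + ord ϖ c) (hda : d - a ≠ 0) (hda' : ord ϖ (d - a) = D) (L : ℕ → ℕ)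
    (hL : ∀ n, (L n : ℤ) = r + (ord ϖ b + ord ϖ c) + max (r : ℤ) (n - D) + 1) :
    (∀ s : ℂ, Integrable
      (orbIntegrand ϖ (testFn σ ϖ r) !![a, b; c, d] ![0, 1] ![0, e] s) μ) ∧
    HasDerivAt (weightedOrb μ ϖ (testFn σ ϖ r) !![a, b; c, d] ![0, 1] ![0, e])
      ((-1) ^ (r + ord ϖ c) * Real.log (residueCard F) *
        ((∑ n ∈ Finset.range (ord ϖ e + 1).toNat, ∑ i ∈ Finset.range (L n),
          (-1) ^ i * ((r + ord ϖ c + 2 * n : ℚ) - i) *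
            (classCount (residueCard F) r (ord ϖ b + ord ϖ c) D n i : ℚ) : ℚ) : ℂ)) 0 := by
  obtain ⟨κ, τ, hc, hτ, ha, hd, hb, hc', hκ, hτ', hτn⟩ := h.exists_normalized hE hσ hϖ
  have hτD := (hτn hda).2
  rw [hda'] at hτD
  refine orbital_integral μ hϖ h.mem_symmetricSpace hc hτ ha hd hb hc' h.e_ne_zero hκ hτ' L
    (classCount (residueCard F) r (ord ϖ b + ord ϖ c) D) (fun n i hi => ?_)
    (fun n i hi => measure_cell_of_small μ h2 hϖ hμ hκ hD hτD n i)
  -- From `L n` on, both roots are nonintegral and too far from the integers for their balls to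
  -- reach them.
  have hLn := hL n
  obtain ⟨x₁, x₂, h1, h2', -, heq⟩ := admissible_eq_union (r := r) hϖ hκ hD hτD (n := n) (i := i)
    (by omega)
  rw [heq, (integral_inter_ball hϖ h1).2 (by omega), (integral_inter_ball hϖ h2').2 (by omega),
    Set.union_empty]

end Nonsplit

end SemiLieAFL

end

open SemiLieAFL in
theorem mainTheorem7
    {p : ℕ} [Fact p.Prime] (hp : p ≠ 2)
    {F : Type*} [NormedField F] [IsUltrametricDist F] [NormedAlgebra ℚ_[p] F]
    [FiniteDimensional ℚ_[p] F]
    {E : Type*} [NormedField E] [NormedAlgebra F E] (hE : IsUnramifiedQuadratic F E)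
    (σ : E ≃ₐ[F] E) (hσ : σ ≠ 1)
    (ϖ : F) (hϖ : IsUniformizer ϖ)
    [MeasurableSpace (Matrix.GeneralLinearGroup (Fin 2) F)]
    [BorelSpace (Matrix.GeneralLinearGroup (Fin 2) F)]
    (μ : MeasureTheory.Measure (Matrix.GeneralLinearGroup (Fin 2) F)) [μ.IsHaarMeasure]
    (hμ : μ (integralGL 2 F) = 1)
    (r : ℕ)
    (a b c d : E) (e : F) (h : IsNonsplitRep σ ϖ a b c d e) (he : 0 ≤ ord ϖ e)
    (a' b' c' d' : E) (e' : F) (h' : IsNonsplitRep σ ϖ a' b' c' d' e')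
    (hb' : ord ϖ b' = ord ϖ b) (hc' : ord ϖ c' = ord ϖ c) (he' : ord ϖ e' = ord ϖ e - 1)
    (hda' : ordTop ϖ (d' - a') = ordTop ϖ (d - a)) :
    (∀ s : ℂ, MeasureTheory.Integrable
      (orbIntegrand ϖ (testFn σ ϖ r) !![a, b; c, d] ![0, 1] ![0, e] s) μ) ∧
    (∀ s : ℂ, MeasureTheory.Integrable
      (orbIntegrand ϖ (testFn σ ϖ r) !![a', b'; c', d'] ![0, 1] ![0, e'] s) μ) ∧
    DifferentiableAt ℂ (weightedOrb μ ϖ (testFn σ ϖ r) !![a, b; c, d] ![0, 1] ![0, e]) 0 ∧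
    DifferentiableAt ℂ (weightedOrb μ ϖ (testFn σ ϖ r) !![a', b'; c', d'] ![0, 1] ![0, e']) 0 ∧
    (-1 : ℂ) ^ ((r : ℤ) + ord ϖ c) / (Real.log (residueCard F) : ℂ) *
        (derivOrb μ ϖ (testFn σ ϖ r) !![a, b; c, d] ![0, 1] ![0, e] +
          derivOrb μ ϖ (testFn σ ϖ r) !![a', b'; c', d'] ![0, 1] ![0, e']) =
      (GK (residueCard F) r (ord ϖ b) (ord ϖ c) (ord ϖ e) (ordTop ϖ (d - a)) : ℂ) := by
  have : ProperSpace F := FiniteDimensional.proper ℚ_[p] F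
  have h2 : (2 : F) ≠ 0 := by
    have := charZero_of_injective_algebraMap (algebraMap ℚ_[p] F).injective
    exact two_ne_zero
  have hlog : (Real.log (residueCard F) : ℂ) ≠ 0 := by
    have := Real.log_pos (show (1 : ℝ) < residueCard F by exact_mod_cast one_lt_residueCard (F := F))
    exact_mod_cast this.ne'
  have hcombine : ∀ {S S' : ℚ} {k : ℤ}, S + S' = GK (residueCard F) r (ord ϖ b) (ord ϖ c) (ord ϖ e)
        (ordTop ϖ (d - a)) →
      (-1 : ℂ) ^ k / (Real.log (residueCard F) : ℂ) *
        ((-1) ^ k * Real.log (residueCard F) * (S : ℂ) +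
          (-1) ^ k * Real.log (residueCard F) * (S' : ℂ)) =
      (GK (residueCard F) r (ord ϖ b) (ord ϖ c) (ord ϖ e) (ordTop ϖ (d - a)) : ℂ) := by
    intro S S' k hS
    have hsq : (-1 : ℂ) ^ k * (-1) ^ k = 1 := by rw [← mul_zpow]; simp
    rw [← hS, Rat.cast_add, ← mul_add, div_mul_eq_mul_div, div_eq_iff hlog]
    linear_combination (S + S' : ℂ) * (Real.log (residueCard F) : ℂ) * hsq
  obtain ⟨_, _, -, -, -, -, hodd, hpos⟩ := h.exists_ratios hE hσ hϖ
  obtain ⟨A, hA⟩ := hodd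
  lift A to ℕ using by omega
  obtain ⟨v, hv⟩ := Int.eq_ofNat_of_zero_le he
  have hV : (ord ϖ e + 1).toNat = v + 1 := by omega
  -- The second sum stops one index earlier; for `v(e) = 0` it is empty.
  have hV' : (ord ϖ e' + 1).toNat = v := by omega
  by_cases hcase : d - a ≠ 0 ∧ 2 * ord ϖ (d - a) < ord ϖ b + ord ϖ c
  · obtain ⟨hda, hlt⟩ := hcase
    obtain ⟨_, _, -, -, -, -, -, -, -, -, hD0⟩ := h.exists_normalized hE hσ hϖ
    obtain ⟨D, hD⟩ := Int.eq_ofNat_of_zero_le (hD0 hda).1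
    have hone : ordTop ϖ (d - a) = ((D : ℤ) : WithTop ℤ) := by rw [ordTop, if_neg hda, hD]
    rw [hone, ordTop] at hda'
    have hda0' : d' - a' ≠ 0 := fun h0 => by simp [h0] at hda'
    rw [if_neg hda0', WithTop.coe_inj] at hda'
    obtain ⟨L, hL⟩ : ∃ L : ℕ → ℕ, ∀ n,
        (L n : ℤ) = r + (ord ϖ b + ord ϖ c) + max (r : ℤ) (n - D) + 1 :=
      ⟨fun n => (r + (ord ϖ b + ord ϖ c) + max (r : ℤ) (n - D) + 1).toNat,
        fun n => Int.toNat_of_nonneg (by omega)⟩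
    obtain ⟨i1, d1⟩ := orbital_integral_small μ hE hσ hϖ h2 hμ r h (D := D) (by omega) hda hD L hL
    obtain ⟨i2, d2⟩ := orbital_integral_small μ hE hσ hϖ h2 hμ r h' (D := D) (by omega) hda0' hda' L
      (by rw [hb', hc']; exact hL)
    refine ⟨i1, i2, d1.differentiableAt, d2.differentiableAt, ?_⟩
    rw [derivOrb, derivOrb, d1.deriv, d2.deriv, hb', hc']
    apply hcombine
    rw [hV, hV', hA]
    rw [doubled_sum_small (residueCard F) r A D v (by omega) _ L (by rw [← hA]; exact hL), hone, GK]
    have hidx : gkIndex r (ord ϖ b) (ord ϖ c) (ord ϖ e) ((D : ℤ) : WithTop ℤ) =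
        min (2 * (v : ℤ)) (2 * (r + D)) := by
      change min (min (2 * ord ϖ e) (ord ϖ b + ord ϖ c + 2 * r)) (2 * (D : ℤ) + 2 * r) = _
      omega
    rw [hidx]
    congr 1
    omega
  · have hlarge : d - a ≠ 0 → ord ϖ b + ord ϖ c < 2 * ord ϖ (d - a) := fun h0 => by
      by_contra hcon
      exact hcase ⟨h0, by omega⟩
    have hlarge' : d' - a' ≠ 0 → ord ϖ b' + ord ϖ c' < 2 * ord ϖ (d' - a') := fun h0 => by
      rw [ordTop, ordTop, if_neg h0] at hda'
      split_ifs at hda' with h1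
      · exact absurd hda' WithTop.coe_ne_top
      rw [WithTop.coe_inj] at hda'
      rw [hda', hb', hc']
      exact hlarge h1
    obtain ⟨i1, d1⟩ := orbital_integral_large μ hE hσ hϖ h2 hμ r h (M := A + r)
      (by push_cast; omega) hlarge
    obtain ⟨i2, d2⟩ := orbital_integral_large μ hE hσ hϖ h2 hμ r h' (M := A + r)
      (by push_cast; omega) hlarge'
    refine ⟨i1, i2, d1.differentiableAt, d2.differentiableAt, ?_⟩
    rw [derivOrb, derivOrb, d1.deriv, d2.deriv, hc']
    apply hcombine
    rw [hV, hV', doubled_sum_large (residueCard F) (A + r) v, GK]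
    have hidx : gkIndex r (ord ϖ b) (ord ϖ c) (ord ϖ e) (ordTop ϖ (d - a)) =
        min (2 * (v : ℤ)) (2 * ((A + r : ℕ) : ℤ) + 1) := by
      rw [ordTop]
      split_ifs with h0
      · change min (2 * ord ϖ e) (ord ϖ b + ord ϖ c + 2 * r) = _
        push_cast; omega
      · change min (min (2 * ord ϖ e) (ord ϖ b + ord ϖ c + 2 * r)) (2 * ord ϖ (d - a) + 2 * r) = _
        have := hlarge h0
        push_cast; omega
    rw [hidx]
    congr 1
    push_cast
    omega
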